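/- Let $D\ge 2$, $N\ge 1$ be integers and $s\in\mathbb R$. A bubble $\mathcal B$ is a finite connected bipartite graph (parallel edges allowed) with $\mathcal V$ white and $\mathcal V$ black vertices whose edges are colored by $[D]=\{1,\dots,D\}$, every vertex being incident to exactly one edge of each color. For a white vertex $a$, let $\tau_c(a)$ be the black vertex joined to $a$ by the edge of color $c$. For a tensor $T=(T_{i_1\cdots i_D})\in\mathbb C^{N^D}$ put $$\mathcal B(T,\bar T)=\sum_{i,j}\ \prod_{a\ \text{white}}T_{i^a_1\cdots i^a_D}\prod_{b\ \text{black}}\bar T_{j^b_1\cdots j^b_D}\ \prod_{c\in[D]}\ \prod_{a\ \text{white}}\delta_{i^a_c,\,j^{\tau_c(a)}_c}.$$ A pairing $\Omega$ of $\mathcal B$ is a bijection $\tau_0$ from the white to the black vertices. Let $\mathcal I_a=\{c\in[D]:\tau_c(a)\ne\tau_0(a)\}$. For every $\mathcal I\subseteq[D]$ let $\sigma_{\mathcal I}$ be a complex matrix of size $N^{|\mathcal I|}\times N^{|\mathcal I|}$, with rows and columns indexed by $\{1,\dots,N\}^{\mathcal I}$, let $\bar\sigma_{\mathcal I}$ be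 its entrywise complex conjugate, and let $\bar{\boldsymbol\sigma}_{\mathcal I}$ be the $N^D\times N^D$ matrix with entries $\bar\sigma_{\mathcal I|(i_k)_{k\in\mathcal I};(j_k)_{k\in\mathcal I}}\prod_{k\notin\mathcal I}\delta_{i_k,j_k}$. Put $$V^\circ_{\mathcal B,\Omega}(\sigma)=\sum_{i,j}\ \prod_{a\ \text{white}}\sigma_{\mathcal I_a|(i^a_q)_{q\in\mathcal I_a};(j^{a}_q)_{q\in\mathcal I_a}}\ \prod_{a\ \text{white}}\ \prod_{q\in\mathcal I_a}\delta_{i^a_q,\;j^{\tau_0^{-1}(\tau_q(a))}_q},\qquad V^\bullet(\bar\sigma)=\mathrm{Tr}\log\Bigl(1+\sum_{\mathcal I\subseteq[D]}\bar{\boldsymbol\sigma}_{\mathcal I}\Bigr),$$ where in $V^\circ_{\mathcal B,\Omega}$ the indices $i^a_q,j^a_q\in\{1,\dots,N\}$ are summed for all white $a$ and $q\in\mathcal I_a$. Let $d\mu_0$ denote the normalized (total mass one) complex Gaussian measure of covariance $N^{-(D-1)}$, i.e. with density proportional to $e^{-N^{D-1}\sum_x|z_x|^2}$, on the entries of $T$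 and on the entries of each $\sigma_{\mathcal I}$ respectively. For $J\in\mathbb C^{N^D}$ write $\bar J\cdot T=\sum_i\bar J_iT_i$, $\bar T\cdot J=\sum_i\bar T_iJ_i$, and $\mathrm{Tr}[(J\otimes\bar J)A]=\sum_{i,j}J_i\,A_{i;j}\,\bar J_j$ for an $N^D\times N^D$ matrix $A$. Theorem. For any bubble $\mathcal B$ and any pairing $\Omega$ of it, $$\int e^{-\lambda N^s\mathcal B(T,\bar T)}\,d\mu_0(T)=\int e^{-(-1)^{\mathcal V}\lambda N^sV^\circ_{\mathcal B,\Omega}(\sigma)-V^\bullet(\bar\sigma)}\prod_{\mathcal I\subseteq[D]}d\mu_0(\sigma_{\mathcal I}),$$ and, for every $J$, $$\int e^{-\lambda N^s\mathcal B(T,\bar T)-\bar J\cdot T-\bar T\cdot J}\,d\mu_0(T)=\int e^{-(-1)^{\mathcal V}\lambda N^sV^\circ_{\mathcal B,\Omega}(\sigma)-V^\bullet(\bar\sigma)+N^{-(D-1)}\mathrm{Tr}\left[(J\otimes\bar J)\left(1+\sum_{\mathcal I}\bar{\boldsymbol\sigma}_{\mathcal I}\right)^{-1}\right]}\prod_{\mathcal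 I\subseteq[D]}d\mu_0(\sigma_{\mathcal I}),$$ so that the logarithms of both sides, the generating function of the cumulants, agree as well. All these equalities are perturbative, i.e. they hold order by order in $\lambda$: the exponentials are expanded in powers of $\lambda$ and integrated term by term, and on the matrix side the factor $\exp(-V^\bullet+\cdots)$ is a formal power series in the entries of the $\bar\sigma_{\mathcal I}$ which is integrated monomial by monomial. At each order in $\lambda$ all the Gaussian integrals that occur converge, and only finitely many of the terms on the matrix side are non-zero. -/

import Mathlib

open MeasureTheory

noncomputable section

namespace TensorMatrix

/-- A closed `D`-colored graph with set of white vertices `W` and set of black vertices `K`: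
a connected bipartite graph, possibly with parallel edges, in which every vertex is incident to
exactly one edge of each color.  The edges of color `c` thus form a perfect matching, the white
vertex `w` being joined to the black vertex `edge c w`. -/
structure Bubble (D : ℕ) (W K : Type*) where
  edge : Fin D → W ≃ K
  connected : (SimpleGraph.fromRel
    (fun x y : W ⊕ K => ∃ c w, x = Sum.inl w ∧ y = Sum.inr (edge c w))).Connected

/-- The positions of the entries of a tensor with `D` indices ranging over `N` values. -/
abbrev TensorIdx (D N : ℕ) := Fin D → Fin N

/-- The positions of the entries of the whole collection of matrices `σ_I`, where `I` runs over
all sets of colors and the rows and columns of `σ_I` are indexed by `I → Fin N`. -/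
abbrev MatrixIdx (D N : ℕ) := Σ I : Finset (Fin D), (I → Fin N) × (I → Fin N)

/-- The normalized complex Gaussian measure `∏ (κ/π) exp (-κ |z_x|²) d(Re z_x) d(Im z_x)`,
for which `z_x` and `conj z_x` have covariance `1/κ`. -/
def gaussian {X : Type*} [Fintype X] (κ : ℝ) : Measure (X → ℂ) :=
  volume.withDensity fun z =>
    ENNReal.ofReal ((κ / Real.pi) ^ Fintype.card X * Real.exp (-κ * ∑ x, ‖z x‖ ^ 2))

/-- The inverse covariance `N^(D-1)`, for the tensor as well as for the matrices. -/
def invCov (D N : ℕ) : ℝ := (N : ℝ) ^ (D - 1)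

/-- For a pairing `Ω` of the white with the black vertices, the set of the colors that are incident
to `w` and do not join `w` to its partner `Ω w`. -/
def Bubble.colors {D : ℕ} {W K : Type*} [DecidableEq K] (G : Bubble D W K) (Ω : W ≃ K) (w : W) : Finset (Fin D) :=
  Finset.univ.filter fun c => G.edge c w ≠ Ω w

theorem Bubble.mem_colors {D : ℕ} {W K : Type*} [DecidableEq K]
    (G : Bubble D W K) (Ω : W ≃ K) {w : W} {c : Fin D}
    (h : c ∈ G.colors Ω w) : c ∈ G.colors Ω (Ω.symm (G.edge c w)) := by
  simp only [colors, Finset.mem_filter, Finset.mem_univ, true_and, Equiv.apply_symm_apply,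
    ne_eq, EmbeddingLike.apply_eq_iff_eq] at h ⊢
  intro h'
  exact h (by rw [Equiv.symm_apply_eq] at h'; exact h')

section Bubbles

variable {D : ℕ} {W K : Type*} [Fintype W] [Fintype K] [DecidableEq W] [DecidableEq K]

/-- The invariant polynomial of a bubble: a copy of `T` on each white vertex, a copy of its complex
conjugate on each black vertex, and the indices of color `c` at the two ends of an edge of color `c`
are identified and summed. -/
def Bubble.invariant (G : Bubble D W K) (N : ℕ) (T : TensorIdx D N → ℂ) : ℂ :=
  ∑ i : W → TensorIdx D N, ∑ j : K → TensorIdx D N,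
    (∏ w, T (i w)) * (∏ b, (starRingEnd ℂ) (T (j b))) *
      ∏ c, ∏ w, if i w c = j (G.edge c w) c then 1 else 0

/-- The matrix potential `V°`: one factor `σ_(I_w)` for each pair `(w, Ω w)`, with row index `i w`
carried by the white vertex `w` and column index `j w` carried by the black vertex `Ω w`; the
indices are contracted along the edges that do not join partners. -/
def Bubble.potential (G : Bubble D W K) (Ω : W ≃ K) (N : ℕ) (σ : MatrixIdx D N → ℂ) : ℂ :=
  ∑ i : (w : W) → G.colors Ω w → Fin N, ∑ j : (w : W) → G.colors Ω w → Fin N,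
    (∏ w, σ ⟨G.colors Ω w, i w, j w⟩) *
      ∏ w, ∏ q : G.colors Ω w,
        if i w q = j (Ω.symm (G.edge q w)) ⟨q, G.mem_colors Ω q.2⟩ then 1 else 0

end Bubbles

section Formal

variable {X : Type*}

/-- The sum of a series of formal power series, coefficient by coefficient (only finitely many
terms contribute to a given coefficient in the uses below). -/
def formalSum (f : ℕ → MvPowerSeries X ℂ) : MvPowerSeries X ℂ :=
  fun n => ∑ᶠ k, MvPowerSeries.coeff n (f k)

/-- The exponential of a formal power series `f` with constant term `f₀`, that is
`exp f₀ * ∑ₖ (f - f₀)^k / k!`. -/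
def formalExp (f : MvPowerSeries X ℂ) : MvPowerSeries X ℂ :=
  MvPowerSeries.C (Complex.exp (MvPowerSeries.constantCoeff f)) *
    formalSum fun k => MvPowerSeries.C ((k.factorial : ℂ)⁻¹) *
      (f - MvPowerSeries.C (MvPowerSeries.constantCoeff f)) ^ k

/-- `Tr log (1 + A) = ∑_{k ≥ 1} (-1)^(k+1)/k Tr A^k`, for a matrix `A` of formal power series
without constant term. -/
def trLog {ι : Type*} [Fintype ι] [DecidableEq ι] (A : Matrix ι ι (MvPowerSeries X ℂ)) :
    MvPowerSeries X ℂ :=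
  formalSum fun k => MvPowerSeries.C ((-1 : ℂ) ^ k / ((k : ℂ) + 1)) * (A ^ (k + 1)).trace

/-- The logarithm of a formal power series `Z` in one variable with constant term `Z₀ ≠ 0`, that is
`log Z₀ + ∑_{k ≥ 1} (-1)^(k+1)/k (Z/Z₀ - 1)^k`. -/
def seriesLog (Z : PowerSeries ℂ) : PowerSeries ℂ :=
  PowerSeries.C (Complex.log (PowerSeries.constantCoeff Z)) +
    PowerSeries.mk fun m => ∑ᶠ k : ℕ, (-1 : ℂ) ^ k / ((k : ℂ) + 1) *
      PowerSeries.coeff m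
        ((PowerSeries.C (PowerSeries.constantCoeff Z)⁻¹ * Z - 1) ^ (k + 1))

/-- One term of the perturbative Gaussian integral: the Gaussian integral of `P(σ)` times the
monomial of exponent `n` in the complex conjugates of the variables. -/
def moment [Fintype X] (κ : ℝ) (P : (X → ℂ) → ℂ) (n : X →₀ ℕ) : ℂ :=
  ∫ σ, P σ * ∏ x, (starRingEnd ℂ) (σ x) ^ n x ∂(gaussian κ)

/-- The perturbative Gaussian integral of `P(σ) F(conj σ)`, for a polynomial `P` and a formal power
series `F`: the series `F` is expanded and integrated term by term. -/
def formalIntegral [Fintype X] (κ : ℝ) (P : (X → ℂ) → ℂ) (F : MvPowerSeries X ℂ) : ℂ :=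
  ∑ᶠ n, MvPowerSeries.coeff n F * moment κ P n

end Formal

/-- The matrix of size `N^D` given by `σ_I` on the indices with color in `I`, and by the identity
on the other indices. -/
def bold {D N : ℕ} {R : Type*} [Zero R] (σ : MatrixIdx D N → R) (I : Finset (Fin D)) :
    Matrix (TensorIdx D N) (TensorIdx D N) R :=
  fun i j => if ∀ k ∉ I, i k = j k then σ ⟨I, fun k => i k, fun k => j k⟩ else 0

/-- `∑_I σ̄_I` as a matrix of size `N^D`; the variable `X (I, i, j)` stands for the complex
conjugate of the entry `(i, j)` of `σ_I`. -/
def conjSum (D N : ℕ) :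
    Matrix (TensorIdx D N) (TensorIdx D N) (MvPowerSeries (MatrixIdx D N) ℂ) :=
  ∑ I : Finset (Fin D), bold (fun x => MvPowerSeries.X x) I

/-- `Tr log (1 + ∑_I σ̄_I)`. -/
def blackPotential (D N : ℕ) : MvPowerSeries (MatrixIdx D N) ℂ := trLog (conjSum D N)

/-- The matrix `J ⊗ J̄`, with entries `J̄_i J_j`, so that
`Tr [(J ⊗ J̄) A] = ∑ J_i A_(i,j) J̄_j`. -/
def sourceMatrix {D N : ℕ} (J : TensorIdx D N → ℂ) :
    Matrix (TensorIdx D N) (TensorIdx D N) (MvPowerSeries (MatrixIdx D N) ℂ) :=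
  fun i j => MvPowerSeries.C ((starRingEnd ℂ) (J i) * J j)

/-- `N^(-(D-1)) Tr [(J ⊗ J̄) (1 + ∑_I σ̄_I)⁻¹]`. -/
def sourceTerm {D N : ℕ} (J : TensorIdx D N → ℂ) : MvPowerSeries (MatrixIdx D N) ℂ :=
  MvPowerSeries.C (((invCov D N)⁻¹ : ℝ) : ℂ) *
    (sourceMatrix J * (1 + conjSum D N)⁻¹).trace

/-- `exp (-J̄·T - T̄·J)`. -/
def sourceFactor {D N : ℕ} (J T : TensorIdx D N → ℂ) : ℂ :=
  Complex.exp (-(∑ a, (starRingEnd ℂ) (J a) * T a) - ∑ a, (starRingEnd ℂ) (T a) * J a)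

section Models

variable {D : ℕ} {W K : Type*} [Fintype W] [Fintype K] [DecidableEq W] [DecidableEq K]

/-- The expansion in powers of `λ` of `∫ exp (-λ N^s B(T, T̄)) dμ₀(T)`. -/
def tensorPartition (G : Bubble D W K) (N : ℕ) (s : ℝ) : PowerSeries ℂ :=
  PowerSeries.mk fun p => (-(((N : ℝ) ^ s : ℝ) : ℂ)) ^ p / (p.factorial : ℂ) *
    ∫ T, G.invariant N T ^ p ∂(gaussian (invCov D N))

/-- The expansion in powers of `λ` of `∫ exp (-λ N^s B(T, T̄) - J̄·T - T̄·J) dμ₀(T)`. -/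
def tensorGenerating (G : Bubble D W K) (N : ℕ) (s : ℝ) (J : TensorIdx D N → ℂ) : PowerSeries ℂ :=
  PowerSeries.mk fun p => (-(((N : ℝ) ^ s : ℝ) : ℂ)) ^ p / (p.factorial : ℂ) *
    ∫ T, G.invariant N T ^ p * sourceFactor J T ∂(gaussian (invCov D N))

/-- The expansion in powers of `λ` of
`∫ exp (-(-1)^V λ N^s V°(σ) - Tr log (1 + ∑_I σ̄_I)) ∏_I dμ₀(σ_I)`,
where `V` is the number of white vertices. -/
def matrixPartition (G : Bubble D W K) (Ω : W ≃ K) (N : ℕ) (s : ℝ) : PowerSeries ℂ :=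
  PowerSeries.mk fun p =>
    (-((-1) ^ Fintype.card W * (((N : ℝ) ^ s : ℝ) : ℂ))) ^ p / (p.factorial : ℂ) *
      formalIntegral (invCov D N) (fun σ => G.potential Ω N σ ^ p)
        (formalExp (-blackPotential D N))

/-- The expansion in powers of `λ` of
`∫ exp (-(-1)^V λ N^s V°(σ) - Tr log (1 + ∑_I σ̄_I)
  + N^(-(D-1)) Tr [(J ⊗ J̄) (1 + ∑_I σ̄_I)⁻¹]) ∏_I dμ₀(σ_I)`. -/
def matrixGenerating (G : Bubble D W K) (Ω : W ≃ K) (N : ℕ) (s : ℝ) (J : TensorIdx D N → ℂ) :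
    PowerSeries ℂ :=
  PowerSeries.mk fun p =>
    (-((-1) ^ Fintype.card W * (((N : ℝ) ^ s : ℝ) : ℂ))) ^ p / (p.factorial : ℂ) *
      formalIntegral (invCov D N) (fun σ => G.potential Ω N σ ^ p)
        (formalExp (-blackPotential D N + sourceTerm J))

end Models

end TensorMatrix

end

noncomputable section

namespace TensorMatrix

open ComplexConjugate

/-! Put κ = N^(D-1), let A = ∑_I σ̄_I, whose entries are linear forms in the variables X_x = σ̄_x,
and define quadratic forms Y_x in T, T̄ by ∑_x X_x Y_x = ∑_(a,b) A_(a,b) T_a T̄_b. The Gaussian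
integral over T of exp(-κ ∑ X_x Y_x - J̄·T - T̄·J) is det(1+A)⁻¹ exp(κ⁻¹ Tr[(J⊗J̄)(1+A)⁻¹]). Thus
the non-polynomial factor of the matrix model is the generating series of the moments of the Y_x.

Under the Gaussian measure of σ, the variable σ̄_x acts on a polynomial P(σ) as κ⁻¹ ∂/∂σ_x,
evaluated at 0 at the end. Integrating P(σ) against exp(-κ ∑ σ̄_x Y_x) therefore evaluates P at -Y,
and what remains is the integral over T of P(-Y). For P a power of V° this is the tensor model: V°
is homogeneous of degree the number of white vertices, and V°(Y) is the bubble invariant, since the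
deltas inside Y contract the edges joining partners and V° contracts the others. The sign from -Y
cancels the one in the coupling.

All this is carried out on coefficients. The determinant formula is `formalExp_eq_genSeries`:
integration by parts gives linear equations for the one-point and two-point series, hence both sides
solve the same Euler equation. The moments of σ are `expect_rename_mul`, the substitution is
`formalIntegral_genSeries`, and the combinatorics of the bubble is `Bubble.potential_quad`. -/

/-- `exp (-J̄·z - z̄·J)`. -/
def linFactor {ι : Type*} [Fintype ι] (J z : ι → ℂ) : ℂ :=
  Complex.exp (-(∑ a, conj (J a) * z a) - ∑ a, conj (z a) * J a)

theorem linFactor_eq_prod {ι : Type*} [Fintype ι] (J z : ι → ℂ) :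
    linFactor J z = ∏ a, Complex.exp (-(conj (J a) * z a) - conj (z a) * J a) := by
  rw [linFactor, ← Complex.exp_sum]
  simp [Finset.sum_sub_distrib, Finset.sum_neg_distrib]

theorem linFactor_zero {ι : Type*} [Fintype ι] (z : ι → ℂ) : linFactor 0 z = 1 := by
  simp [linFactor]

/-- The evaluation of a polynomial at `z` and the complex conjugate of `z`. -/
def evalConj {ι : Type*} (z : ι → ℂ) : MvPolynomial (ι ⊕ ι) ℂ →+* ℂ :=
  MvPolynomial.eval (Sum.elim z fun a => conj (z a))

/-! ### Gaussian integrals with a linear source in one complex variable. -/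

section OneVariable

theorem pow_mul_exp_le {κ : ℝ} (hκ : 0 < κ) (c : ℝ) (n : ℕ) :
    ∃ C, ∀ r : ℝ, 0 ≤ r → r ^ n * Real.exp (c * r) * Real.exp (-κ * r ^ 2) ≤
      C * Real.exp (-(κ / 2) * r ^ 2) := by
  -- After `r ^ n ≤ n! * exp r`, half of the Gaussian is left to absorb exp((c+1)r), and (c+1)²/(2κ)
  -- is the maximum of (c+1)r - κr²/2.
  refine ⟨n.factorial * Real.exp ((c + 1) ^ 2 / (2 * κ)), fun r hr => ?_⟩
  have h1 : r ^ n ≤ n.factorial * Real.exp r := by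
    have := Real.pow_div_factorial_le_exp r hr n
    rwa [div_le_iff₀ (by positivity), mul_comm] at this
  calc r ^ n * Real.exp (c * r) * Real.exp (-κ * r ^ 2)
      ≤ n.factorial * Real.exp r * Real.exp (c * r) * Real.exp (-κ * r ^ 2) := by gcongr
    _ = n.factorial * Real.exp (r + c * r + -κ * r ^ 2) := by
        rw [Real.exp_add, Real.exp_add]; ring
    _ ≤ n.factorial * Real.exp ((c + 1) ^ 2 / (2 * κ) + -(κ / 2) * r ^ 2) := by
        refine mul_le_mul_of_nonneg_left (Real.exp_le_exp.2 ?_) (by positivity)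
        have : (c + 1) ^ 2 / (2 * κ) + -(κ / 2) * r ^ 2 - (r + c * r + -κ * r ^ 2) =
            (κ * r - (c + 1)) ^ 2 / (2 * κ) := by
          field_simp; ring
        have : 0 ≤ (κ * r - (c + 1)) ^ 2 / (2 * κ) := by positivity
        linarith
    _ = _ := by rw [Real.exp_add]; ring

theorem integrable_exp_neg_mul_sq_norm {κ : ℝ} (hκ : 0 < κ) :
    Integrable fun z : ℂ => Real.exp (-κ * ‖z‖ ^ 2) := by
  have h := GaussianFourier.integrable_cexp_neg_mul_sq_norm_add (V := ℂ) (b := (κ : ℂ))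
    (by simpa using hκ) 0 0
  refine h.norm.congr (.of_forall fun z => ?_)
  simp only [zero_mul, add_zero, Complex.norm_exp]
  norm_cast

theorem integrable_monomial_gaussian {κ : ℝ} (hκ : 0 < κ) (j : ℂ) (m n : ℕ) :
    Integrable fun z : ℂ => z ^ m * conj z ^ n *
      (Complex.exp (-(conj j * z) - conj z * j) * Complex.exp (-κ * (‖z‖ : ℂ) ^ 2)) := by
  obtain ⟨C, hC⟩ := pow_mul_exp_le hκ (2 * ‖j‖) (m + n)
  refine ((integrable_exp_neg_mul_sq_norm (half_pos hκ)).const_mul C).mono'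
    (Continuous.aestronglyMeasurable (by fun_prop)) (.of_forall fun z => ?_)
  refine le_trans ?_ (hC ‖z‖ (norm_nonneg z))
  have h1 : (-(conj j * z) - conj z * j).re ≤ 2 * ‖j‖ * ‖z‖ := by
    refine (Complex.re_le_norm _).trans ((norm_sub_le _ _).trans ?_)
    simp only [norm_neg, norm_mul, RCLike.norm_conj]
    linarith
  have h2 : (-κ * (‖z‖ : ℂ) ^ 2).re = -κ * ‖z‖ ^ 2 := by norm_cast
  simp only [norm_mul, norm_pow, RCLike.norm_conj, Complex.norm_exp, h2, ← mul_assoc, ← pow_add]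
  gcongr

theorem integral_linear_gaussian {κ : ℝ} (hκ : 0 < κ) (j : ℂ) :
    ∫ z : ℂ, Complex.exp (-(conj j * z) - conj z * j) * Complex.exp (-κ * (‖z‖ : ℂ) ^ 2) =
      (Real.pi / κ : ℝ) * Complex.exp ((κ : ℂ)⁻¹ * (conj j * j)) := by
  -- The source term is -2 times the real inner product of `j` and `z`, so completing the square
  -- gives (-2)²|j|²/(4κ) = |j|²/κ.
  have h := GaussianFourier.integral_cexp_neg_mul_sq_norm_add (V := ℂ) (b := (κ : ℂ))
    (by simpa using hκ) (-2) j
  have e1 : ∀ z : ℂ, Complex.exp (-(conj j * z) - conj z * j) *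
      Complex.exp (-κ * (‖z‖ : ℂ) ^ 2) =
      Complex.exp (-κ * (‖z‖ : ℂ) ^ 2 + -2 * (inner ℝ j z : ℝ)) := by
    intro z
    rw [← Complex.exp_add]
    congr 1
    have : conj j * z + conj z * j = 2 * ((inner ℝ j z : ℝ) : ℂ) := by
      rw [Complex.inner]
      have := Complex.add_conj (conj j * z)
      simp only [map_mul, Complex.conj_conj] at this
      rw [mul_comm z (conj j)]
      push_cast at this
      rw [← this]; ring
    linear_combination -this
  simp_rw [e1, h]
  have e2 : (conj j * j : ℂ) = (‖j‖ : ℂ) ^ 2 := by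
    rw [mul_comm, Complex.mul_conj]; norm_cast; exact Complex.normSq_eq_norm_sq j
  rw [e2]
  simp only [Complex.finrank_real_complex]
  have hk : (κ : ℂ) ≠ 0 := by exact_mod_cast hκ.ne'
  congr 1
  · norm_num
  · congr 1; field_simp; ring

end OneVariable

/-- The derivative of a polynomial in `z` and its complex conjugate in a coordinate direction. -/
theorem hasDerivAt_evalConj {ι : Type*} [DecidableEq ι] (q : MvPolynomial (ι ⊕ ι) ℂ) (z : ι → ℂ) (j : ι) (v : ℂ) :
    HasDerivAt (fun t : ℝ => evalConj (z + t • (Pi.single j v : ι → ℂ)) q)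
      (v * evalConj z (MvPolynomial.pderiv (.inl j) q) +
        conj v * evalConj z (MvPolynomial.pderiv (.inr j) q)) 0 := by
  induction q using MvPolynomial.induction_on with
  | C c => simpa [evalConj] using hasDerivAt_const (0 : ℝ) c
  | add p q hp hq =>
    simp only [map_add]
    exact (hp.add hq).congr_deriv (by ring)
  | mul_X p x hp =>
    have hx : HasDerivAt (fun t : ℝ => evalConj (z + t • (Pi.single j v : ι → ℂ)) (MvPolynomial.X x))
        (v * evalConj z (MvPolynomial.pderiv (.inl j) (MvPolynomial.X x)) +
        conj v * evalConj z (MvPolynomial.pderiv (.inr j) (MvPolynomial.X x))) 0 := by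
      have hid : HasDerivAt (fun t : ℝ => (t : ℂ)) 1 0 := Complex.ofRealCLM.hasDerivAt
      rcases x with a | a
      · by_cases h : a = j
        · subst h
          simpa [evalConj] using (hid.mul_const v).const_add (z a)
        · simpa [evalConj, h, Ne.symm h] using hasDerivAt_const (0 : ℝ) (z a)
      · by_cases h : a = j
        · subst h
          simpa [evalConj] using (hid.mul_const (conj v)).const_add (conj (z a))
        · simpa [evalConj, h, Ne.symm h] using hasDerivAt_const (0 : ℝ) (conj (z a))
    simp only [map_mul, MvPolynomial.pderiv_mul, map_add]
    refine (hp.mul hx).congr_deriv ?_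
    simp only [zero_smul, add_zero]
    ring

/-! ### Polynomials times a Gaussian weight in several complex variables. -/

section SeveralVariables

variable {ι : Type*} [Fintype ι]

/-- A polynomial in `z` and its complex conjugate times the density of a Gaussian measure with a
linear source. -/
def gaussWeight (κ : ℝ) (J : ι → ℂ) (q : MvPolynomial (ι ⊕ ι) ℂ) (z : ι → ℂ) : ℂ :=
  evalConj z q * (linFactor J z * Complex.exp (-κ * ∑ a, (‖z a‖ : ℂ) ^ 2))

theorem gaussWeight_add (κ : ℝ) (J : ι → ℂ) (p q : MvPolynomial (ι ⊕ ι) ℂ) (z : ι → ℂ) :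
    gaussWeight κ J (p + q) z = gaussWeight κ J p z + gaussWeight κ J q z := by
  simp [gaussWeight, add_mul]

theorem gaussWeight_monomial (κ : ℝ) (J : ι → ℂ) (m : ι ⊕ ι →₀ ℕ) (c : ℂ) (z : ι → ℂ) :
    gaussWeight κ J (MvPolynomial.monomial m c) z =
      c * ∏ a, (z a ^ m (.inl a) * conj (z a) ^ m (.inr a) *
        (Complex.exp (-(conj (J a) * z a) - conj (z a) * J a) *
          Complex.exp (-κ * (‖z a‖ : ℂ) ^ 2))) := by
  rw [gaussWeight, linFactor_eq_prod, Finset.mul_sum, Complex.exp_sum, evalConj,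
    MvPolynomial.eval_monomial, Finsupp.prod_fintype _ _ (by simp), Fintype.prod_sum_type]
  simp only [Sum.elim_inl, Sum.elim_inr, Finset.prod_mul_distrib]
  ring

theorem integrable_gaussWeight {κ : ℝ} (hκ : 0 < κ) (J : ι → ℂ) (q : MvPolynomial (ι ⊕ ι) ℂ) :
    Integrable (gaussWeight κ J q) := by
  induction q using MvPolynomial.induction_on' with
  | monomial m c =>
    have h : gaussWeight κ J (MvPolynomial.monomial m c) = _ :=
      funext (gaussWeight_monomial κ J m c)
    rw [h]
    exact (Integrable.fintype_prod fun a =>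
      integrable_monomial_gaussian hκ (J a) (m (.inl a)) (m (.inr a))).const_mul c
  | add p q hp hq =>
    have h : gaussWeight κ J (p + q) = gaussWeight κ J p + gaussWeight κ J q :=
      funext (gaussWeight_add κ J p q)
    rw [h]
    exact hp.add hq

theorem integral_gaussWeight_one {κ : ℝ} (hκ : 0 < κ) (J : ι → ℂ) :
    ∫ z, gaussWeight κ J 1 z =
      ((Real.pi / κ : ℝ) : ℂ) ^ Fintype.card ι *
        Complex.exp ((κ : ℂ)⁻¹ * ∑ a, conj (J a) * J a) := by
  have h := gaussWeight_monomial κ J 0 1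
  simp only [MvPolynomial.monomial_zero', map_one, Finsupp.coe_zero, Pi.zero_apply, pow_zero,
    one_mul] at h
  simp_rw [h]
  rw [integral_fintype_prod_volume_eq_prod
    (f := fun a z => Complex.exp (-(conj (J a) * z) - conj z * J a) *
      Complex.exp (-κ * (‖z‖ : ℂ) ^ 2))]
  simp_rw [integral_linear_gaussian hκ]
  rw [Finset.prod_mul_distrib, ← Complex.exp_sum, Finset.mul_sum]
  simp only [Finset.prod_const, Finset.card_univ]

/-- The exponent of the Gaussian weight, as a polynomial. -/
def weightExponent (κ : ℝ) (J : ι → ℂ) : MvPolynomial (ι ⊕ ι) ℂ :=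
  ∑ a, (-(MvPolynomial.C (conj (J a)) * MvPolynomial.X (.inl a))
    - MvPolynomial.C (J a) * MvPolynomial.X (.inr a)
    - MvPolynomial.C (κ : ℂ) * (MvPolynomial.X (.inl a) * MvPolynomial.X (.inr a)))

theorem gaussWeight_eq (κ : ℝ) (J : ι → ℂ) (q : MvPolynomial (ι ⊕ ι) ℂ) (z : ι → ℂ) :
    gaussWeight κ J q z =
      evalConj z q * Complex.exp (evalConj z (weightExponent κ J)) := by
  rw [gaussWeight, linFactor, ← Complex.exp_add]
  congr 2
  simp only [weightExponent, evalConj, map_sum, map_sub, map_neg, map_mul, MvPolynomial.eval_C,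
    MvPolynomial.eval_X, Sum.elim_inl, Sum.elim_inr, Finset.sum_sub_distrib,
    Finset.sum_neg_distrib, ← Finset.mul_sum, Complex.mul_conj']
  simp only [mul_comm (J _)]
  ring

/-! ### Wirtinger derivatives of the weight and integration by parts. -/

section Derivatives

variable [DecidableEq ι]

/-- The polynomial `p` with `∂(q w)/∂z_j = p w`, where `w` is the Gaussian weight with source. -/
def leftOp (κ : ℝ) (J : ι → ℂ) (j : ι) (q : MvPolynomial (ι ⊕ ι) ℂ) : MvPolynomial (ι ⊕ ι) ℂ :=
  MvPolynomial.pderiv (.inl j) q -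
    (MvPolynomial.C (conj (J j)) * q + MvPolynomial.C (κ : ℂ) * (MvPolynomial.X (.inr j) * q))

/-- The polynomial `p` with `∂(q w)/∂z̄_j = p w`, where `w` is the Gaussian weight with source. -/
def rightOp (κ : ℝ) (J : ι → ℂ) (j : ι) (q : MvPolynomial (ι ⊕ ι) ℂ) : MvPolynomial (ι ⊕ ι) ℂ :=
  MvPolynomial.pderiv (.inr j) q -
    (MvPolynomial.C (J j) * q + MvPolynomial.C (κ : ℂ) * (MvPolynomial.X (.inl j) * q))

theorem pderiv_inl_weightExponent (κ : ℝ) (J : ι → ℂ) (j : ι) :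
    MvPolynomial.pderiv (.inl j) (weightExponent κ J) =
      -(MvPolynomial.C (conj (J j)) + MvPolynomial.C (κ : ℂ) * MvPolynomial.X (.inr j)) := by
  rw [weightExponent, map_sum, Finset.sum_eq_single j]
  · simp
    ring
  · intro a _ ha
    simp [ha]
  · simp

theorem pderiv_inr_weightExponent (κ : ℝ) (J : ι → ℂ) (j : ι) :
    MvPolynomial.pderiv (.inr j) (weightExponent κ J) =
      -(MvPolynomial.C (J j) + MvPolynomial.C (κ : ℂ) * MvPolynomial.X (.inl j)) := by
  rw [weightExponent, map_sum, Finset.sum_eq_single j]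
  · simp
    ring
  · intro a _ ha
    simp [ha]
  · simp

/-- The derivative along the real direction `v` in coordinate `j` is v∂ + v̄∂̄, and both Wirtinger
derivatives preserve the class of polynomials times the weight. -/
theorem hasLineDerivAt_gaussWeight (κ : ℝ) (J : ι → ℂ) (q : MvPolynomial (ι ⊕ ι) ℂ)
    (z : ι → ℂ) (j : ι) (v : ℂ) :
    HasLineDerivAt ℝ (gaussWeight κ J q)
      (v * gaussWeight κ J (leftOp κ J j q) z +
        conj v * gaussWeight κ J (rightOp κ J j q) z) z (Pi.single j v) := by
  have h1 := hasDerivAt_evalConj q z j v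
  have h2 := (hasDerivAt_evalConj (weightExponent κ J) z j v).cexp
  have h := h1.mul h2
  rw [pderiv_inl_weightExponent, pderiv_inr_weightExponent] at h
  refine (h.congr_of_eventuallyEq (.of_forall fun t => gaussWeight_eq κ J q _)).congr_deriv ?_
  simp only [gaussWeight_eq, leftOp, rightOp, map_sub, map_add, map_mul, map_neg, zero_smul,
    add_zero]
  ring

theorem integral_lineDeriv_gaussWeight {κ : ℝ} (hκ : 0 < κ) (J : ι → ℂ)
    (q : MvPolynomial (ι ⊕ ι) ℂ) (j : ι) (v : ℂ) :
    v * (∫ z, gaussWeight κ J (leftOp κ J j q) z) +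
      conj v * (∫ z, gaussWeight κ J (rightOp κ J j q) z) = 0 := by
  have il := (integrable_gaussWeight hκ J (leftOp κ J j q)).const_mul v
  have ir := (integrable_gaussWeight hκ J (rightOp κ J j q)).const_mul (conj v)
  -- Integration by parts against the constant 1: a line derivative has integral zero.
  have h := integral_bilinear_hasLineDerivAt_right_eq_neg_left_of_integrable
    (μ := (volume : Measure (ι → ℂ))) (v := Pi.single j v)
    (f := fun _ => (1 : ℂ)) (f' := fun _ => 0) (g := gaussWeight κ J q)
    (B := ContinuousLinearMap.mul ℝ ℂ) (by simp)
    (by simpa only [ContinuousLinearMap.mul_apply', one_mul] using! il.add ir) (by simpa using integrable_gaussWeight hκ J q)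
    (fun x _ => by simpa [HasLineDerivAt] using hasDerivAt_const (0 : ℝ) (1 : ℂ))
    (fun x _ => hasLineDerivAt_gaussWeight κ J q x j v)
  simp only [ContinuousLinearMap.mul_apply', one_mul, zero_mul, integral_zero, neg_zero] at h
  rw [integral_add il ir, integral_const_mul, integral_const_mul] at h
  exact h

/-- The real directions 1 and i give a + b = 0 and i(a - b) = 0 for the two Wirtinger integrals,
which separates them. -/
theorem integral_leftOp_rightOp {κ : ℝ} (hκ : 0 < κ) (J : ι → ℂ)
    (q : MvPolynomial (ι ⊕ ι) ℂ) (j : ι) :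
    ∫ z, gaussWeight κ J (leftOp κ J j q) z = 0 ∧
      ∫ z, gaussWeight κ J (rightOp κ J j q) z = 0 := by
  have h1 := integral_lineDeriv_gaussWeight hκ J q j 1
  have h2 := integral_lineDeriv_gaussWeight hκ J q j Complex.I
  simp only [map_one, one_mul, Complex.conj_I] at h1 h2
  set a := ∫ z, gaussWeight κ J (leftOp κ J j q) z
  set b := ∫ z, gaussWeight κ J (rightOp κ J j q) z
  have h3 : a - b = 0 := by
    have : Complex.I * (a - b) = 0 := by linear_combination h2
    simpa using this
  constructor
  · linear_combination (h1 + h3) / 2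
  · linear_combination (h1 - h3) / 2

end Derivatives

/-! ### Expectations of polynomials under the Gaussian measure. -/

section Measure

theorem gaussian_density_toReal {κ : ℝ} (hκ : 0 < κ) (z : ι → ℂ) :
    (ENNReal.ofReal ((κ / Real.pi) ^ Fintype.card ι * Real.exp (-κ * ∑ x, ‖z x‖ ^ 2))).toReal =
      (κ / Real.pi) ^ Fintype.card ι * Real.exp (-κ * ∑ x, ‖z x‖ ^ 2) :=
  ENNReal.toReal_ofReal (by positivity)

theorem measurable_gaussian_density (κ : ℝ) :
    Measurable fun z : ι → ℂ =>
      ENNReal.ofReal ((κ / Real.pi) ^ Fintype.card ι * Real.exp (-κ * ∑ x, ‖z x‖ ^ 2)) := by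
  fun_prop

theorem density_smul_eq {κ : ℝ} (hκ : 0 < κ) (J : ι → ℂ) (q : MvPolynomial (ι ⊕ ι) ℂ)
    (z : ι → ℂ) :
    (ENNReal.ofReal ((κ / Real.pi) ^ Fintype.card ι *
      Real.exp (-κ * ∑ x, ‖z x‖ ^ 2))).toReal • (evalConj z q * linFactor J z) =
      ((κ / Real.pi : ℝ) : ℂ) ^ Fintype.card ι * gaussWeight κ J q z := by
  rw [gaussian_density_toReal hκ, gaussWeight, Complex.real_smul]
  push_cast
  ring

theorem integrable_gaussian {κ : ℝ} (hκ : 0 < κ) (J : ι → ℂ) (q : MvPolynomial (ι ⊕ ι) ℂ) :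
    Integrable (fun z => evalConj z q * linFactor J z) (gaussian κ) := by
  rw [gaussian, integrable_withDensity_iff_integrable_smul' (measurable_gaussian_density κ)
    (.of_forall fun _ => ENNReal.ofReal_lt_top)]
  simp_rw [density_smul_eq hκ]
  exact (integrable_gaussWeight hκ J q).const_mul _

theorem integral_gaussian {κ : ℝ} (hκ : 0 < κ) (J : ι → ℂ) (q : MvPolynomial (ι ⊕ ι) ℂ) :
    ∫ z, evalConj z q * linFactor J z ∂(gaussian κ) =
      ((κ / Real.pi : ℝ) : ℂ) ^ Fintype.card ι * ∫ z, gaussWeight κ J q z := by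
  rw [gaussian, integral_withDensity_eq_integral_toReal_smul (measurable_gaussian_density κ)
    (.of_forall fun _ => ENNReal.ofReal_lt_top)]
  simp_rw [density_smul_eq hκ]
  rw [integral_const_mul]

/-- The expectation of a polynomial in the variables and their conjugates, with a source. -/
def expect {κ : ℝ} (hκ : 0 < κ) (J : ι → ℂ) : MvPolynomial (ι ⊕ ι) ℂ →ₗ[ℂ] ℂ where
  toFun q := ∫ z, evalConj z q * linFactor J z ∂(gaussian κ)
  map_add' p q := by
    simp_rw [map_add, add_mul]
    exact integral_add (integrable_gaussian hκ J p) (integrable_gaussian hκ J q)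
  map_smul' c q := by
    rw [← integral_smul]
    simp [evalConj, MvPolynomial.smul_eval, mul_assoc]

theorem expect_one {κ : ℝ} (hκ : 0 < κ) (J : ι → ℂ) :
    expect hκ J 1 = Complex.exp ((κ : ℂ)⁻¹ * ∑ a, conj (J a) * J a) := by
  rw [expect, LinearMap.coe_mk, AddHom.coe_mk, integral_gaussian hκ, integral_gaussWeight_one hκ,
    ← mul_assoc, ← mul_pow]
  have : (κ / Real.pi) * (Real.pi / κ) = 1 := by field_simp
  rw [← Complex.ofReal_mul, this]
  simp

theorem expect_C_mul {κ : ℝ} (hκ : 0 < κ) (J : ι → ℂ) (c : ℂ) (q : MvPolynomial (ι ⊕ ι) ℂ) :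
    expect hκ J (MvPolynomial.C c * q) = c * expect hκ J q := by
  rw [MvPolynomial.C_mul', map_smul, smul_eq_mul]

/-- Integration by parts. -/
theorem expect_X_inr_mul {κ : ℝ} (hκ : 0 < κ) (J : ι → ℂ) (j : ι) (q : MvPolynomial (ι ⊕ ι) ℂ) :
    κ * expect hκ J (MvPolynomial.X (.inr j) * q) =
      expect hκ J (MvPolynomial.pderiv (.inl j) q) - conj (J j) * expect hκ J q := by
  classical
  have h : expect hκ J (leftOp κ J j q) = 0 := by
    rw [expect, LinearMap.coe_mk, AddHom.coe_mk, integral_gaussian hκ,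
      (integral_leftOp_rightOp hκ J q j).1, mul_zero]
  rw [leftOp, map_sub, map_add, expect_C_mul, expect_C_mul] at h
  linear_combination -h

theorem expect_X_inl_mul {κ : ℝ} (hκ : 0 < κ) (J : ι → ℂ) (j : ι) (q : MvPolynomial (ι ⊕ ι) ℂ) :
    κ * expect hκ J (MvPolynomial.X (.inl j) * q) =
      expect hκ J (MvPolynomial.pderiv (.inr j) q) - J j * expect hκ J q := by
  classical
  have h : expect hκ J (rightOp κ J j q) = 0 := by
    rw [expect, LinearMap.coe_mk, AddHom.coe_mk, integral_gaussian hκ,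
      (integral_leftOp_rightOp hκ J q j).2, mul_zero]
  rw [rightOp, map_sub, map_add, expect_C_mul, expect_C_mul] at h
  linear_combination -h

end Measure

end SeveralVariables

/-! ### The Euler operator on formal power series and the exponential. -/

section FormalSeries

variable {X : Type*}

/-- The derivation that multiplies the part of degree `d` of a formal power series by `d`. -/
def euler : Derivation ℂ (MvPowerSeries X ℂ) (MvPowerSeries X ℂ) :=
  Derivation.mk'
    { toFun f := fun n => (n.degree : ℂ) * MvPowerSeries.coeff n f
      map_add' f g := by
        ext n
        exact mul_add _ _ _
      map_smul' c f := by
        ext n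
        exact mul_left_comm _ _ _ }
    (fun f g => by
      classical
      ext n
      change (n.degree : ℂ) * MvPowerSeries.coeff n (f * g) = _
      rw [smul_eq_mul, smul_eq_mul, mul_comm g, map_add, MvPowerSeries.coeff_mul,
        MvPowerSeries.coeff_mul, MvPowerSeries.coeff_mul, Finset.mul_sum, ← Finset.sum_add_distrib]
      refine Finset.sum_congr rfl fun p hp => ?_
      change _ = MvPowerSeries.coeff p.1 f * ((p.2.degree : ℂ) * MvPowerSeries.coeff p.2 g) +
        (p.1.degree : ℂ) * MvPowerSeries.coeff p.1 f * MvPowerSeries.coeff p.2 g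
      rw [← Finset.HasAntidiagonal.mem_antidiagonal.1 hp, map_add]
      push_cast
      ring)

theorem coeff_euler (n : X →₀ ℕ) (f : MvPowerSeries X ℂ) :
    MvPowerSeries.coeff n (euler f) = (n.degree : ℂ) * MvPowerSeries.coeff n f :=
  rfl

theorem euler_C (c : ℂ) : euler (MvPowerSeries.C c : MvPowerSeries X ℂ) = 0 :=
  euler.map_algebraMap c

theorem euler_C_mul (c : ℂ) (f : MvPowerSeries X ℂ) :
    euler (MvPowerSeries.C c * f) = MvPowerSeries.C c * euler f := by
  rw [euler.leibniz, euler_C, smul_zero, add_zero, smul_eq_mul]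

theorem euler_X (x : X) : euler (MvPowerSeries.X x : MvPowerSeries X ℂ) = MvPowerSeries.X x := by
  classical
  ext n
  rw [coeff_euler, MvPowerSeries.coeff_X]
  split_ifs with h
  · simp [h]
  · simp

theorem coeff_zero_euler (f : MvPowerSeries X ℂ) : MvPowerSeries.coeff 0 (euler f) = 0 := by
  rw [coeff_euler]
  simp

theorem degree_snd_lt {n : X →₀ ℕ} {p : (X →₀ ℕ) × (X →₀ ℕ)} (hp : p.1 + p.2 = n)
    (h : p.1 ≠ 0) : p.2.degree < n.degree := by
  rw [← hp, map_add]
  have := mt (Finsupp.degree_eq_zero_iff p.1).1 h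
  lia

/-- A solution of a differential equation `E F = h F` is determined by its constant term. -/
theorem eq_of_euler_eq {h F G : MvPowerSeries X ℂ} (h0 : MvPowerSeries.coeff 0 h = 0)
    (hF : euler F = h * F) (hG : euler G = h * G)
    (hFG : MvPowerSeries.coeff 0 F = MvPowerSeries.coeff 0 G) : F = G := by
  classical
  ext n
  induction hd : n.degree using Nat.strong_induction_on generalizing n with
  | _ d ih =>
    by_cases hn : n = 0
    · rw [hn, hFG]
    have hn' : (n.degree : ℂ) ≠ 0 := by
      exact_mod_cast mt (Finsupp.degree_eq_zero_iff n).1 hn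
    apply mul_left_cancel₀ hn'
    rw [← coeff_euler, ← coeff_euler, hF, hG, MvPowerSeries.coeff_mul, MvPowerSeries.coeff_mul]
    refine Finset.sum_congr rfl fun p hp => ?_
    -- Since `h` has no constant term, only coefficients of `F` and `G` of smaller degree
    -- contribute.
    by_cases h1 : p.1 = 0
    · rw [h1, h0, zero_mul, zero_mul]
    · rw [ih p.2.degree (hd ▸ degree_snd_lt (Finset.HasAntidiagonal.mem_antidiagonal.1 hp) h1) p.2 rfl]

theorem coeff_formalSum {f : ℕ → MvPowerSeries X ℂ} {n : X →₀ ℕ} {d : ℕ}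
    (h : ∀ k, d ≤ k → MvPowerSeries.coeff n (f k) = 0) :
    MvPowerSeries.coeff n (formalSum f) = ∑ k ∈ Finset.range d, MvPowerSeries.coeff n (f k) := by
  refine finsum_eq_sum_of_support_subset _ fun k hk => ?_
  by_contra hk'
  exact hk (h k (by simpa using hk'))

theorem coeff_pow_eq_zero {g : MvPowerSeries X ℂ} (hg : MvPowerSeries.constantCoeff g = 0)
    {n : X →₀ ℕ} {k : ℕ} (h : n.degree < k) : MvPowerSeries.coeff n (g ^ k) = 0 :=
  MvPowerSeries.coeff_of_lt_order
    (lt_of_lt_of_le (by exact_mod_cast h) (MvPowerSeries.le_order_pow_of_constantCoeff_eq_zero k hg))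

/-- The partial sums of the exponential series. -/
def expPartial (g : MvPowerSeries X ℂ) (d : ℕ) : MvPowerSeries X ℂ :=
  ∑ k ∈ Finset.range d, MvPowerSeries.C ((k.factorial : ℂ)⁻¹) * g ^ k

/-- Differentiating g^(k+1)/(k+1)! gives E(g) g^k/k!, so exactly one term of the partial sum is
lost. -/
theorem euler_expPartial (g : MvPowerSeries X ℂ) (d : ℕ) :
    euler (expPartial g (d + 1)) = euler g * expPartial g d := by
  rw [expPartial, map_sum, Finset.sum_range_succ', expPartial, Finset.mul_sum]
  simp only [euler_C_mul, pow_zero, euler.map_one_eq_zero, mul_zero, add_zero]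
  refine Finset.sum_congr rfl fun k _ => ?_
  rw [euler.leibniz_pow, Nat.add_sub_cancel, smul_eq_mul, nsmul_eq_mul]
  have h : MvPowerSeries.C ((k.factorial : ℂ)⁻¹) =
      (MvPowerSeries.C (((k + 1).factorial : ℂ)⁻¹) * ((k + 1 : ℕ) : MvPowerSeries X ℂ)) := by
    rw [← map_natCast (MvPowerSeries.C (σ := X) (R := ℂ)), ← map_mul, Nat.factorial_succ]
    congr 1
    have : (k.factorial : ℂ) ≠ 0 := by exact_mod_cast k.factorial_ne_zero
    have : ((k + 1 : ℕ) : ℂ) ≠ 0 := by exact_mod_cast k.succ_ne_zero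
    push_cast at *
    field_simp
  rw [h]
  ring

theorem coeff_formalSum_exp {g : MvPowerSeries X ℂ} (hg : MvPowerSeries.constantCoeff g = 0)
    {n : X →₀ ℕ} {d : ℕ} (h : n.degree < d) :
    MvPowerSeries.coeff n (formalSum fun k => MvPowerSeries.C ((k.factorial : ℂ)⁻¹) * g ^ k) =
      MvPowerSeries.coeff n (expPartial g d) := by
  rw [coeff_formalSum (d := d), expPartial, map_sum]
  intro k hk
  rw [MvPowerSeries.coeff_C_mul, coeff_pow_eq_zero hg (h.trans_le hk), mul_zero]

theorem euler_formalExp (f : MvPowerSeries X ℂ) :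
    euler (formalExp f) = euler f * formalExp f := by
  classical
  set g := f - MvPowerSeries.C (MvPowerSeries.constantCoeff f) with hg
  have hg0 : MvPowerSeries.constantCoeff g = 0 := by simp [hg]
  have hE : euler f = euler g := by rw [hg, map_sub, euler_C, sub_zero]
  rw [formalExp, euler_C_mul, ← hg, hE, mul_left_comm]
  congr 1
  ext n
  -- One term beyond the required `degree + 1`, because `euler_expPartial` consumes one.
  rw [coeff_euler, coeff_formalSum_exp hg0 (d := n.degree + 2) (by lia), ← coeff_euler,
    euler_expPartial, MvPowerSeries.coeff_mul, MvPowerSeries.coeff_mul]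
  refine Finset.sum_congr rfl fun p hp => ?_
  rw [coeff_formalSum_exp hg0 (d := n.degree + 1)]
  rw [← Finset.HasAntidiagonal.mem_antidiagonal.1 hp, map_add]
  lia

theorem coeff_zero_formalExp (f : MvPowerSeries X ℂ) :
    MvPowerSeries.coeff 0 (formalExp f) = Complex.exp (MvPowerSeries.coeff 0 f) := by
  have h : MvPowerSeries.constantCoeff
      (f - MvPowerSeries.C (MvPowerSeries.constantCoeff f)) = 0 := by simp
  rw [formalExp, MvPowerSeries.coeff_C_mul, coeff_formalSum_exp h (d := 1) (by simp)]
  simp [expPartial]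

/-! ### Matrices of linear forms: inverse and trace of the logarithm. -/

section Matrices

variable {ι : Type*} [Fintype ι]

theorem euler_matrix_mul (M N : Matrix ι ι (MvPowerSeries X ℂ)) :
    (M * N).map euler = M.map euler * N + M * N.map euler := by
  ext1 i j
  simp only [Matrix.map_apply, Matrix.mul_apply, Matrix.add_apply, map_sum, euler.leibniz,
    smul_eq_mul, Finset.sum_add_distrib]
  rw [add_comm]
  simp only [mul_comm (N _ _)]

theorem euler_trace (M : Matrix ι ι (MvPowerSeries X ℂ)) :
    euler M.trace = (M.map euler).trace := by
  simp [Matrix.trace]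

variable [DecidableEq ι] {A : Matrix ι ι (MvPowerSeries X ℂ)}

/-- The hypothesis `hA`, used throughout, says that the entries of `A` are homogeneous of degree
one; by the product rule those of `A ^ k` have degree `k`. -/
theorem euler_matrix_pow (hA : A.map euler = A) (k : ℕ) :
    (A ^ k).map euler = (k : MvPowerSeries X ℂ) • A ^ k := by
  induction k with
  | zero =>
    ext1 i j
    by_cases h : i = j <;> simp [h]
  | succ k ih =>
    rw [pow_succ, euler_matrix_mul, ih, hA, Matrix.smul_mul]
    push_cast
    rw [add_smul, one_smul]

theorem coeff_matrix_pow (hA : A.map euler = A) {k : ℕ} {n : X →₀ ℕ} (h : n.degree ≠ k)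
    (i j : ι) : MvPowerSeries.coeff n ((A ^ k) i j) = 0 := by
  have h1 := congrArg (MvPowerSeries.coeff n) (congrFun (congrFun (euler_matrix_pow hA k) i) j)
  rw [Matrix.map_apply, coeff_euler, Matrix.smul_apply, smul_eq_mul,
    ← map_natCast (MvPowerSeries.C (σ := X) (R := ℂ)), MvPowerSeries.coeff_C_mul] at h1
  have h2 : ((n.degree : ℂ) - k) ≠ 0 := sub_ne_zero.2 (by exact_mod_cast h)
  have h3 : ((n.degree : ℂ) - k) * MvPowerSeries.coeff n ((A ^ k) i j) = 0 := by
    linear_combination h1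
  exact (mul_eq_zero.1 h3).resolve_left h2

theorem coeff_zero_of_euler (hA : A.map euler = A) (i j : ι) :
    MvPowerSeries.constantCoeff (A i j) = 0 := by
  have := coeff_matrix_pow hA (k := 1) (n := 0) (by simp) i j
  rwa [pow_one] at this

theorem isUnit_det_one_add (hA : A.map euler = A) : IsUnit (1 + A).det := by
  rw [MvPowerSeries.isUnit_iff_constantCoeff, RingHom.map_det]
  have : (MvPowerSeries.constantCoeff (σ := X) (R := ℂ)).mapMatrix (1 + A) = 1 := by
    rw [map_add, map_one]
    ext i j
    simp [coeff_zero_of_euler hA]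
  rw [this]
  simp

theorem one_add_mul_inv (hA : A.map euler = A) : (1 + A) * (1 + A)⁻¹ = 1 :=
  Matrix.mul_nonsing_inv _ (isUnit_det_one_add hA)

theorem inv_mul_one_add (hA : A.map euler = A) : (1 + A)⁻¹ * (1 + A) = 1 :=
  Matrix.nonsing_inv_mul _ (isUnit_det_one_add hA)

theorem coeff_zero_inv (hA : A.map euler = A) (i j : ι) :
    MvPowerSeries.constantCoeff ((1 + A)⁻¹ i j) = (1 : Matrix ι ι ℂ) i j := by
  have h := congrArg (MvPowerSeries.constantCoeff (σ := X) (R := ℂ)).mapMatrix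
    (one_add_mul_inv hA)
  have : (MvPowerSeries.constantCoeff (σ := X) (R := ℂ)).mapMatrix (1 + A) = 1 := by
    rw [map_add, map_one]
    ext i j
    simp [coeff_zero_of_euler hA]
  rw [map_mul, this, one_mul, map_one] at h
  exact congrFun (congrFun h i) j

/-- Apply the product rule to (1+A)(1+A)⁻¹ = 1. -/
theorem euler_inv (hA : A.map euler = A) :
    ((1 + A)⁻¹).map euler = -((1 + A)⁻¹ * A * (1 + A)⁻¹) := by
  have h := congrArg (fun M : Matrix ι ι (MvPowerSeries X ℂ) => M.map euler) (one_add_mul_inv hA)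
  have h1 : (1 : Matrix ι ι (MvPowerSeries X ℂ)).map euler = 0 := by
    ext1 i j
    by_cases h : i = j <;> simp [h]
  have h2 : (1 + A).map euler = A := by
    rw [Matrix.map_add _ (map_add euler), h1, hA, zero_add]
  simp only [euler_matrix_mul, h1, h2] at h
  have h3 := congrArg (fun M => (1 + A)⁻¹ * M) h
  simp only [mul_add, mul_zero, ← mul_assoc, inv_mul_one_add hA, one_mul] at h3
  exact eq_neg_of_add_eq_zero_right h3

/-- The geometric series with remainder, by iterating (1+A)⁻¹ = 1 - A(1+A)⁻¹. The remainder contains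
A^(d+1), hence is invisible in degrees up to `d`. -/
theorem mul_inv_eq_sum (hA : A.map euler = A) (d : ℕ) :
    A * (1 + A)⁻¹ = ∑ k ∈ Finset.range d, (-1 : MvPowerSeries X ℂ) ^ k • A ^ (k + 1) +
      (-1 : MvPowerSeries X ℂ) ^ d • (A ^ (d + 1) * (1 + A)⁻¹) := by
  have h : (1 + A)⁻¹ = 1 - A * (1 + A)⁻¹ := by
    have := one_add_mul_inv hA
    rw [add_mul, one_mul] at this
    exact eq_sub_of_add_eq this
  induction d with
  | zero => simp
  | succ d ih =>
    have h2 : A ^ (d + 1) * (1 + A)⁻¹ = A ^ (d + 1) - A ^ (d + 2) * (1 + A)⁻¹ := by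
      conv_lhs => rw [h]
      rw [mul_sub, mul_one, ← mul_assoc, ← pow_succ]
    rw [ih, Finset.sum_range_succ, h2, smul_sub, pow_succ (-1 : MvPowerSeries X ℂ) d]
    simp only [mul_neg, mul_one, neg_smul]
    abel

theorem coeff_mul_eq_zero {f g : MvPowerSeries X ℂ} {n : X →₀ ℕ}
    (h : ∀ m : X →₀ ℕ, m.degree ≤ n.degree → MvPowerSeries.coeff m f = 0) :
    MvPowerSeries.coeff n (f * g) = 0 := by
  classical
  rw [MvPowerSeries.coeff_mul]
  refine Finset.sum_eq_zero fun p hp => ?_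
  rw [h p.1, zero_mul]
  rw [← Finset.HasAntidiagonal.mem_antidiagonal.1 hp, map_add]
  lia

/-- By homogeneity the Euler operator cancels the denominator `k + 1` in the logarithm, leaving the
trace of the geometric series. -/
theorem euler_trLog (hA : A.map euler = A) :
    euler (trLog A) = (A * (1 + A)⁻¹).trace := by
  have htr : ∀ (k : ℕ) (n : X →₀ ℕ), n.degree ≠ k →
      MvPowerSeries.coeff n (A ^ k).trace = 0 := fun k n h => by
    simp [Matrix.trace, coeff_matrix_pow hA h]
  ext n
  have hrem : MvPowerSeries.coeff n
      ((-1 : MvPowerSeries X ℂ) ^ (n.degree + 1) • (A ^ (n.degree + 1 + 1) * (1 + A)⁻¹)).trace = 0 := by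
    rw [Matrix.trace_smul, smul_eq_mul, mul_comm]
    refine coeff_mul_eq_zero fun m hm => ?_
    simp only [Matrix.trace, Matrix.diag, Matrix.mul_apply, map_sum]
    refine Finset.sum_eq_zero fun i _ => Finset.sum_eq_zero fun j _ => ?_
    exact coeff_mul_eq_zero fun l hl => coeff_matrix_pow hA (by lia) i j
  rw [mul_inv_eq_sum hA (n.degree + 1), Matrix.trace_add, map_add, hrem, add_zero, coeff_euler,
    trLog, coeff_formalSum (d := n.degree + 1), Matrix.trace_sum, map_sum, Finset.mul_sum]
  · refine Finset.sum_congr rfl fun k _ => ?_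
    have hC : ((-1 : MvPowerSeries X ℂ) ^ k) = MvPowerSeries.C ((-1 : ℂ) ^ k) := by simp
    rw [Matrix.trace_smul, smul_eq_mul, hC, MvPowerSeries.coeff_C_mul, MvPowerSeries.coeff_C_mul]
    by_cases hk : n.degree = k + 1
    · have : ((k : ℂ) + 1) ≠ 0 := by exact_mod_cast k.succ_ne_zero
      rw [hk]
      push_cast
      field_simp
    · rw [htr _ _ hk]
      ring
  · intro k hk
    rw [MvPowerSeries.coeff_C_mul, htr _ _ (by lia), mul_zero]

theorem coeff_zero_trLog (hA : A.map euler = A) : MvPowerSeries.coeff 0 (trLog A) = 0 := by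
  rw [trLog, coeff_formalSum (d := 0)]
  · simp
  · intro k _
    simp [Matrix.trace, coeff_matrix_pow hA (k := k + 1) (n := 0) (by simp)]

end Matrices

end FormalSeries

/-- The chain rule, needed for monomials in the quadratic forms and for renamed variables. -/
theorem derivation_aeval {σ S : Type*} [Fintype σ] [CommRing S] [Algebra ℂ S]
    (D : Derivation ℂ S S) (Y : σ → S) (p : MvPolynomial σ ℂ) :
    D (MvPolynomial.aeval Y p) =
      ∑ x, MvPolynomial.aeval Y (MvPolynomial.pderiv x p) * D (Y x) := by
  classical
  induction p using MvPolynomial.induction_on with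
  | C c => simp
  | add p q hp hq => simp [hp, hq, add_mul, Finset.sum_add_distrib]
  | mul_X p y hp =>
    simp only [map_mul, MvPolynomial.aeval_X, D.leibniz, hp, smul_eq_mul, MvPolynomial.pderiv_mul,
      MvPolynomial.pderiv_X, map_add, add_mul, Finset.sum_add_distrib, Finset.mul_sum]
    rw [add_comm]
    congr 1
    · exact Finset.sum_congr rfl fun x _ => by ring
    · rw [Finset.sum_eq_single y]
      · simp
      · intro x _ hx
        simp [hx.symm]
      · simp

/-! ### The generating series of quadratic forms and its Schwinger–Dyson equations. -/

section Generating

/-- The matrix of linear forms `∑ α_(a,b,x) X_x`. -/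
def linMatrix {ι X : Type*} [Fintype X] (α : ι → ι → X → ℂ) : Matrix ι ι (MvPowerSeries X ℂ) :=
  fun a b => ∑ x, MvPowerSeries.C (α a b x) * MvPowerSeries.X x

theorem euler_linMatrix {ι X : Type*} [Fintype X] (α : ι → ι → X → ℂ) :
    (linMatrix α).map euler = linMatrix α := by
  ext1 a b
  simp only [Matrix.map_apply, linMatrix, map_sum, euler_C_mul, euler_X]

/-- The matrix `J ⊗ J̄` of constant power series. -/
def constSource {ι : Type*} (X : Type*) (J : ι → ℂ) : Matrix ι ι (MvPowerSeries X ℂ) :=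
  fun i j => MvPowerSeries.C (conj (J i) * J j)

theorem C_inv_mul_C {X : Type*} {κ : ℝ} (hκ : 0 < κ) :
    (MvPowerSeries.C (κ : ℂ)⁻¹ : MvPowerSeries X ℂ) * MvPowerSeries.C (κ : ℂ) = 1 := by
  rw [← map_mul, inv_mul_cancel₀ (by exact_mod_cast hκ.ne'), map_one]


variable {ι X : Type*} [Fintype ι] [Fintype X]

/-- The quadratic form `∑ α_(a,b,x) z_a z̄_b`. -/
def quadForm (α : ι → ι → X → ℂ) (x : X) : MvPolynomial (ι ⊕ ι) ℂ :=
  ∑ a, ∑ b, MvPolynomial.C (α a b x) * (MvPolynomial.X (.inl a) * MvPolynomial.X (.inr b))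

/-- The monomial of exponent `n` in the quadratic forms. -/
def quadMonomial (α : ι → ι → X → ℂ) (n : X →₀ ℕ) : MvPolynomial (ι ⊕ ι) ℂ :=
  MvPolynomial.aeval (quadForm α) (MvPolynomial.monomial n (1 : ℂ))

theorem quadMonomial_eq_prod (α : ι → ι → X → ℂ) (n : X →₀ ℕ) :
    quadMonomial α n = ∏ x, quadForm α x ^ n x := by
  rw [quadMonomial, MvPolynomial.aeval_monomial, map_one, one_mul,
    Finsupp.prod_fintype _ _ (by simp)]

variable {κ : ℝ} (hκ : 0 < κ) (J : ι → ℂ) (α : ι → ι → X → ℂ)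

/-- The factor `(-κ)^|n| / n!`. -/
def expCoeff (κ : ℝ) (n : X →₀ ℕ) : ℂ := (-κ : ℂ) ^ n.degree / ∏ x, ((n x).factorial : ℂ)

theorem expCoeff_sub [DecidableEq X] (κ : ℝ) {n : X →₀ ℕ} {x : X} (h : n x ≠ 0) :
    (-κ : ℂ) * expCoeff κ (n - Finsupp.single x 1) = n x * expCoeff κ n := by
  obtain ⟨m, rfl⟩ : ∃ m, n = m + Finsupp.single x 1 :=
    ⟨n - Finsupp.single x 1, (tsub_add_cancel_of_le (by simpa [Nat.one_le_iff_ne_zero])).symm⟩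
  rw [add_tsub_cancel_right, expCoeff, expCoeff]
  have h1 : ∏ y, (((m + Finsupp.single x 1 : X →₀ ℕ) y).factorial : ℂ) =
      (m x + 1) * ∏ y, ((m y).factorial : ℂ) := by
    rw [← Finset.mul_prod_erase _ _ (Finset.mem_univ x),
      ← Finset.mul_prod_erase Finset.univ (fun y => ((m y).factorial : ℂ)) (Finset.mem_univ x),
      ← mul_assoc]
    congr 1
    · simp [Nat.factorial_succ]
    · refine Finset.prod_congr rfl fun y hy => ?_
      simp [(Finset.ne_of_mem_erase hy).symm]
  have h2 : ∏ y, ((m y).factorial : ℂ) ≠ 0 :=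
    Finset.prod_ne_zero_iff.2 fun y _ => by exact_mod_cast (m y).factorial_ne_zero
  have h3 : ((m x : ℂ) + 1) ≠ 0 := by exact_mod_cast (m x).succ_ne_zero
  rw [h1, map_add, Finsupp.degree_single, pow_succ]
  simp only [Finsupp.coe_add, Pi.add_apply, Finsupp.single_eq_same]
  push_cast
  field_simp

/-- The formal power series of the expectations of `q exp (-κ ∑ X_x Y_x)`, where `Y_x` are the
quadratic forms. -/
def genSeries : MvPolynomial (ι ⊕ ι) ℂ →ₗ[ℂ] MvPowerSeries X ℂ where
  toFun q := fun n => expCoeff κ n * expect hκ J (quadMonomial α n * q)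
  map_add' p q := by
    ext n
    change expCoeff κ n * expect hκ J (quadMonomial α n * (p + q)) =
      expCoeff κ n * expect hκ J (quadMonomial α n * p) +
        expCoeff κ n * expect hκ J (quadMonomial α n * q)
    rw [mul_add, map_add, mul_add]
  map_smul' c q := by
    ext n
    change expCoeff κ n * expect hκ J (quadMonomial α n * (c • q)) =
      c * (expCoeff κ n * expect hκ J (quadMonomial α n * q))
    rw [mul_smul_comm, map_smul, smul_eq_mul, mul_left_comm]

theorem coeff_genSeries (n : X →₀ ℕ) (q : MvPolynomial (ι ⊕ ι) ℂ) :
    MvPowerSeries.coeff n (genSeries hκ J α q) =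
      expCoeff κ n * expect hκ J (quadMonomial α n * q) :=
  rfl

theorem genSeries_C_mul (c : ℂ) (q : MvPolynomial (ι ⊕ ι) ℂ) :
    genSeries hκ J α (MvPolynomial.C c * q) = MvPowerSeries.C c * genSeries hκ J α q := by
  rw [MvPolynomial.C_mul', map_smul, MvPowerSeries.smul_eq_C_mul]

/-- Differentiating a monomial in the Y_x produces `n x` and lowers the exponent; on the generating
series this is multiplication by -κ X_x, as for a true exponential. -/
theorem coeff_X_mul_genSeries [DecidableEq X] (n : X →₀ ℕ) (x : X)
    (q : MvPolynomial (ι ⊕ ι) ℂ) :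
    -κ * MvPowerSeries.coeff n (MvPowerSeries.X x * genSeries hκ J α q) =
      expCoeff κ n * (n x * expect hκ J (quadMonomial α (n - Finsupp.single x 1) * q)) := by
  rw [MvPowerSeries.X, MvPowerSeries.coeff_monomial_mul, coeff_genSeries]
  by_cases h : n x = 0
  · simp [h]
  · rw [if_pos (by simpa [Nat.one_le_iff_ne_zero]), one_mul, ← mul_assoc, expCoeff_sub κ h]
    ring

theorem sum_X_mul_genSeries {τ : Type*} [Fintype τ]
    (f : τ → MvPolynomial (ι ⊕ ι) ℂ) (γ : τ → X → ℂ) :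
    ∑ x, MvPowerSeries.X x * genSeries hκ J α (∑ b, MvPolynomial.C (γ b x) * f b) =
      ∑ b, (∑ x, MvPowerSeries.C (γ b x) * MvPowerSeries.X x) * genSeries hκ J α (f b) := by
  simp only [map_sum, genSeries_C_mul, Finset.mul_sum, Finset.sum_mul]
  rw [Finset.sum_comm]
  exact Finset.sum_congr rfl fun b _ => Finset.sum_congr rfl fun x _ => by ring

/-- The Euler operator brings down the exponent -κ ∑ X_x Y_x: the degree is the sum of the `n x`,
and each lowered monomial regains its factor Y_x. -/
theorem euler_genSeries (q : MvPolynomial (ι ⊕ ι) ℂ) :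
    euler (genSeries hκ J α q) =
      MvPowerSeries.C (-κ : ℂ) *
        ∑ x, MvPowerSeries.X x * genSeries hκ J α (quadForm α x * q) := by
  classical
  ext n
  rw [coeff_euler, MvPowerSeries.coeff_C_mul, map_sum, Finset.mul_sum]
  simp only [coeff_X_mul_genSeries]
  rw [← Finset.mul_sum, coeff_genSeries, mul_left_comm, Finsupp.degree_eq_sum]
  congr 1
  push_cast
  rw [Finset.sum_mul]
  refine Finset.sum_congr rfl fun x _ => ?_
  by_cases h : n x = 0
  · simp [h]
  · congr 2
    have hn : n = (n - Finsupp.single x 1) + Finsupp.single x 1 :=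
      (tsub_add_cancel_of_le (by simpa [Nat.one_le_iff_ne_zero])).symm
    have : quadMonomial α n = quadMonomial α (n - Finsupp.single x 1) * quadForm α x := by
      conv_lhs => rw [hn, quadMonomial, MvPolynomial.monomial_add_single, pow_one, map_mul,
        MvPolynomial.aeval_X]
      rfl
    rw [this, mul_assoc]

/-- The product rule for a derivation applied to q exp(-κ ∑ X_x Y_x), read coefficient by
coefficient. -/
theorem expect_derivation_quadMonomial
    (D : Derivation ℂ (MvPolynomial (ι ⊕ ι) ℂ) (MvPolynomial (ι ⊕ ι) ℂ)) (n : X →₀ ℕ)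
    (q : MvPolynomial (ι ⊕ ι) ℂ) :
    expCoeff κ n * expect hκ J (D (quadMonomial α n * q)) =
      MvPowerSeries.coeff n (genSeries hκ J α (D q) + MvPowerSeries.C (-κ : ℂ) *
        ∑ x, MvPowerSeries.X x * genSeries hκ J α (D (quadForm α x) * q)) := by
  classical
  rw [map_add, MvPowerSeries.coeff_C_mul, map_sum, Finset.mul_sum]
  simp only [coeff_X_mul_genSeries]
  rw [D.leibniz, smul_eq_mul, smul_eq_mul, map_add, mul_add, coeff_genSeries, ← Finset.mul_sum]
  congr 2
  rw [quadMonomial, derivation_aeval, Finset.mul_sum, map_sum]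
  refine Finset.sum_congr rfl fun x _ => ?_
  have hx : MvPolynomial.aeval (quadForm α) (MvPolynomial.pderiv x (MvPolynomial.monomial n (1 : ℂ))) =
      (n x : ℂ) • quadMonomial α (n - Finsupp.single x 1) := by
    rw [MvPolynomial.pderiv_monomial, one_mul, quadMonomial, ← map_smul,
      MvPolynomial.smul_monomial, smul_eq_mul, mul_one]
  rw [hx, smul_mul_assoc, mul_smul_comm, map_smul, smul_eq_mul, mul_left_comm, mul_comm q]

/-- Integration by parts in z_j. The derivative of ∑ X_x Y_x is ∑_b A_(j,b) z̄_b, so the equation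
closes on the series of z̄_b q. -/
theorem genSeries_X_inr_mul (j : ι) (q : MvPolynomial (ι ⊕ ι) ℂ) :
    MvPowerSeries.C (κ : ℂ) * genSeries hκ J α (MvPolynomial.X (.inr j) * q) =
      genSeries hκ J α (MvPolynomial.pderiv (.inl j) q) + MvPowerSeries.C (-κ : ℂ) *
        ∑ b, linMatrix α j b * genSeries hκ J α (MvPolynomial.X (.inr b) * q) -
      MvPowerSeries.C (conj (J j)) * genSeries hκ J α q := by
  classical
  have hY : ∀ x, MvPolynomial.pderiv (.inl j) (quadForm α x) * q =
      ∑ b, MvPolynomial.C (α j b x) * (MvPolynomial.X (.inr b) * q) := by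
    intro x
    rw [quadForm, map_sum, Finset.sum_eq_single j]
    · simp [Finset.sum_mul, mul_assoc]
    · intro a _ ha
      simp [ha]
    · simp
  have h := fun n => expect_derivation_quadMonomial hκ J α (MvPolynomial.pderiv (.inl j)) n q
  simp only [hY] at h
  simp only [sum_X_mul_genSeries hκ J α (fun b => MvPolynomial.X (.inr b) * q) (fun b x => α j b x)] at h
  ext n
  rw [map_sub, MvPowerSeries.coeff_C_mul, MvPowerSeries.coeff_C_mul]
  simp only [linMatrix]
  rw [← h n, coeff_genSeries, coeff_genSeries, mul_left_comm _ (MvPolynomial.X _), mul_left_comm,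
    expect_X_inr_mul]
  ring

theorem genSeries_X_inl_mul (j : ι) (q : MvPolynomial (ι ⊕ ι) ℂ) :
    MvPowerSeries.C (κ : ℂ) * genSeries hκ J α (MvPolynomial.X (.inl j) * q) =
      genSeries hκ J α (MvPolynomial.pderiv (.inr j) q) + MvPowerSeries.C (-κ : ℂ) *
        ∑ a, linMatrix α a j * genSeries hκ J α (MvPolynomial.X (.inl a) * q) -
      MvPowerSeries.C (J j) * genSeries hκ J α q := by
  classical
  have hY : ∀ x, MvPolynomial.pderiv (.inr j) (quadForm α x) * q =
      ∑ a, MvPolynomial.C (α a j x) * (MvPolynomial.X (.inl a) * q) := by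
    intro x
    rw [quadForm, map_sum, Finset.sum_mul]
    refine Finset.sum_congr rfl fun a _ => ?_
    rw [map_sum, Finset.sum_eq_single j]
    · simp [mul_assoc]
    · intro b _ hb
      simp [hb]
    · simp
  have h := fun n => expect_derivation_quadMonomial hκ J α (MvPolynomial.pderiv (.inr j)) n q
  simp only [hY] at h
  simp only [sum_X_mul_genSeries hκ J α (fun b => MvPolynomial.X (.inl b) * q) (fun b x => α b j x)] at h
  ext n
  rw [map_sub, MvPowerSeries.coeff_C_mul, MvPowerSeries.coeff_C_mul]
  simp only [linMatrix]
  rw [← h n, coeff_genSeries, coeff_genSeries, mul_left_comm _ (MvPolynomial.X _), mul_left_comm,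
    expect_X_inl_mul]
  ring

theorem genSeries_inl_eq (i : ι) :
    genSeries hκ J α (MvPolynomial.X (.inl i)) +
        ∑ a, linMatrix α a i * genSeries hκ J α (MvPolynomial.X (.inl a)) =
      -(MvPowerSeries.C (κ : ℂ)⁻¹ * MvPowerSeries.C (J i) * genSeries hκ J α 1) := by
  have h := genSeries_X_inl_mul hκ J α i 1
  simp only [mul_one, MvPolynomial.pderiv_one, map_zero, zero_add, map_neg] at h
  set v := genSeries hκ J α (MvPolynomial.X (.inl i))
  set S := ∑ a, linMatrix α a i * genSeries hκ J α (MvPolynomial.X (.inl a))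
  linear_combination (MvPowerSeries.C (κ : ℂ)⁻¹) * h - (v + S) * C_inv_mul_C (X := X) hκ

/-- The matrix of the series of `z̄_j z_i`. -/
def twoPoint : Matrix ι ι (MvPowerSeries X ℂ) :=
  fun j i => genSeries hκ J α (MvPolynomial.X (.inr j) * MvPolynomial.X (.inl i))

/-- The matrix with entries the product of `J̄_j` with the series of `z_i`. -/
def onePoint : Matrix ι ι (MvPowerSeries X ℂ) :=
  fun j i => MvPowerSeries.C (conj (J j)) * genSeries hκ J α (MvPolynomial.X (.inl i))

theorem euler_genSeries_one :
    euler (genSeries hκ J α 1) =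
      -(MvPowerSeries.C (κ : ℂ) * (linMatrix α * twoPoint hκ J α).trace) := by
  have hY : ∀ x, quadForm α x * 1 = ∑ b : ι × ι, MvPolynomial.C (α b.1 b.2 x) *
      (MvPolynomial.X (.inr b.2) * MvPolynomial.X (.inl b.1)) := by
    intro x
    rw [mul_one, quadForm, Fintype.sum_prod_type]
    simp only [mul_comm (MvPolynomial.X (Sum.inr _))]
  rw [euler_genSeries, map_neg, neg_mul]
  simp only [hY]
  have h := sum_X_mul_genSeries hκ J α
    (fun b : ι × ι => MvPolynomial.X (.inr b.2) * MvPolynomial.X (.inl b.1))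
    (fun b x => α b.1 b.2 x)
  rw [Fintype.sum_prod_type] at h
  exact congrArg (fun S => -(MvPowerSeries.C (κ : ℂ) * S)) h

variable [DecidableEq ι]

theorem genSeries_inr_inl_eq (j i : ι) :
    genSeries hκ J α (MvPolynomial.X (.inr j) * MvPolynomial.X (.inl i)) +
        ∑ b, linMatrix α j b *
          genSeries hκ J α (MvPolynomial.X (.inr b) * MvPolynomial.X (.inl i)) =
      MvPowerSeries.C (κ : ℂ)⁻¹ * ((1 : Matrix ι ι (MvPowerSeries X ℂ)) j i * genSeries hκ J α 1 -
        MvPowerSeries.C (conj (J j)) * genSeries hκ J α (MvPolynomial.X (.inl i))) := by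
  have h := genSeries_X_inr_mul hκ J α j (MvPolynomial.X (.inl i))
  have h1 : genSeries hκ J α (MvPolynomial.pderiv (.inl j) (MvPolynomial.X (.inl i))) =
      (1 : Matrix ι ι (MvPowerSeries X ℂ)) j i * genSeries hκ J α 1 := by
    by_cases hij : j = i
    · subst hij; simp
    · simp [hij, Ne.symm hij]
  rw [h1] at h
  simp only [map_neg] at h
  set v := genSeries hκ J α (MvPolynomial.X (.inr j) * MvPolynomial.X (.inl i))
  set S := ∑ b, linMatrix α j b *
    genSeries hκ J α (MvPolynomial.X (.inr b) * MvPolynomial.X (.inl i))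
  linear_combination (MvPowerSeries.C (κ : ℂ)⁻¹) * h - (v + S) * C_inv_mul_C (X := X) hκ

theorem onePoint_mul :
    onePoint hκ J α * (1 + linMatrix α) =
      (-(MvPowerSeries.C (κ : ℂ)⁻¹ * genSeries hκ J α 1)) • constSource X J := by
  rw [mul_add, mul_one]
  ext1 j i
  have h := genSeries_inl_eq hκ J α i
  simp only [Matrix.smul_apply, Matrix.add_apply, Matrix.mul_apply, smul_eq_mul, onePoint,
    constSource, map_mul]
  have e : ∑ x, MvPowerSeries.C (conj (J j)) * genSeries hκ J α (MvPolynomial.X (.inl x)) *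
      linMatrix α x i = MvPowerSeries.C (conj (J j)) *
        ∑ a, linMatrix α a i * genSeries hκ J α (MvPolynomial.X (.inl a)) := by
    rw [Finset.mul_sum]
    exact Finset.sum_congr rfl fun x _ => by ring
  rw [e]
  linear_combination MvPowerSeries.C (conj (J j)) * h

theorem mul_twoPoint :
    (1 + linMatrix α) * twoPoint hκ J α =
      (MvPowerSeries.C (κ : ℂ)⁻¹ : MvPowerSeries X ℂ) • (genSeries hκ J α 1 • 1 - onePoint hκ J α) := by
  rw [add_mul, one_mul]
  ext1 j i
  have h := genSeries_inr_inl_eq hκ J α j i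
  simp only [Matrix.smul_apply, Matrix.add_apply, Matrix.sub_apply, Matrix.mul_apply, smul_eq_mul,
    onePoint, twoPoint]
  rw [h]
  ring

/-- `exp (-Tr log (1 + A) + κ⁻¹ Tr [(J ⊗ J̄) (1 + A)⁻¹])` is the generating series of the
expectations of the quadratic forms. -/
theorem formalExp_eq_genSeries :
    formalExp (-trLog (linMatrix α) + MvPowerSeries.C (κ : ℂ)⁻¹ *
      (constSource X J * (1 + linMatrix α)⁻¹).trace) = genSeries hκ J α 1 := by
  have hA := euler_linMatrix α
  set A := linMatrix α with hAdef
  set B := (1 + A)⁻¹ with hB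
  set g := genSeries hκ J α 1 with hg
  have hS : (constSource X J).map euler = 0 := by
    ext1 i j
    exact euler_C _
  -- Inverting 1 + A on the right, then on the left, solves the two linear systems.
  have hone : onePoint hκ J α = (-(MvPowerSeries.C (κ : ℂ)⁻¹ * g)) • (constSource X J * B) := by
    rw [← Matrix.smul_mul, ← onePoint_mul, mul_assoc, one_add_mul_inv hA, mul_one]
  have htwo : twoPoint hκ J α =
      (MvPowerSeries.C (κ : ℂ)⁻¹ : MvPowerSeries X ℂ) • (g • B - B * onePoint hκ J α) := by
    have h := congrArg (fun M => B * M) (mul_twoPoint hκ J α)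
    simp only [← mul_assoc, hB, ← hAdef, inv_mul_one_add hA, one_mul] at h
    rw [h, Matrix.mul_smul, mul_sub, Matrix.mul_smul, mul_one]
  refine eq_of_euler_eq (coeff_zero_euler _) (euler_formalExp _) ?_ ?_
  -- With S = J⊗J̄, the solved two-point matrix gives -κ Tr(A·twoPoint) = -(Tr AB + κ⁻¹ Tr(ABSB)) g.
  -- By cyclicity the bracket with its sign is the Euler derivative of the exponent.
  · have htr : (B * (constSource X J * B) * A).trace = (constSource X J * (B * A * B)).trace := by
      rw [mul_assoc, Matrix.trace_mul_comm, ← mul_assoc, ← mul_assoc, mul_assoc, mul_assoc]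
    rw [euler_genSeries_one, htwo, hone, map_add, map_neg, euler_trLog hA, euler_C_mul,
      euler_trace, euler_matrix_mul, hS, zero_mul, zero_add, euler_inv hA, Matrix.mul_smul,
      Matrix.trace_smul, smul_eq_mul, ← mul_assoc, mul_comm (MvPowerSeries.C (κ : ℂ)),
      C_inv_mul_C hκ, one_mul, mul_sub, Matrix.trace_sub, Matrix.mul_smul, Matrix.trace_smul,
      Matrix.mul_smul, Matrix.mul_smul, Matrix.trace_smul, mul_neg, Matrix.trace_neg,
      Matrix.trace_mul_comm A (B * _), htr, ← hB]
    simp only [smul_eq_mul]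
    ring
  -- Both constant terms are exp(κ⁻¹ ∑ |J_a|²), because `B` has constant term 1.
  · rw [coeff_zero_formalExp, coeff_genSeries, map_add, map_neg, coeff_zero_trLog hA,
      MvPowerSeries.coeff_C_mul]
    have h1 : expCoeff κ (0 : X →₀ ℕ) = 1 := by simp [expCoeff]
    have h2 : quadMonomial α 0 = 1 := by simp [quadMonomial]
    rw [h1, h2, one_mul, one_mul, expect_one, neg_zero, zero_add]
    congr 2
    simp only [Matrix.trace, Matrix.diag, Matrix.mul_apply, map_sum]
    refine Finset.sum_congr rfl fun i _ => ?_
    rw [Finset.sum_eq_single i]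
    · rw [constSource, MvPowerSeries.coeff_C_mul]
      have := coeff_zero_inv hA i i
      rw [Matrix.one_apply_eq] at this
      rw [hB]
      exact (congrArg _ this).trans (mul_one _)
    · intro j _ hj
      rw [constSource, MvPowerSeries.coeff_C_mul]
      have := coeff_zero_inv hA j i
      rw [Matrix.one_apply_ne hj] at this
      exact (congrArg _ this).trans (mul_zero _)
    · simp

end Generating

/-! ### Gaussian moments of the matrices and substitution of the quadratic forms. -/

section Moments

variable {ι X : Type*} [Fintype ι] [Fintype X] {κ : ℝ} (hκ : 0 < κ)

theorem rename_eq_aeval {σ τ : Type*} (f : σ → τ) (P : MvPolynomial σ ℂ) :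
    MvPolynomial.rename f P = MvPolynomial.aeval (fun x => MvPolynomial.X (f x)) P := by
  induction P using MvPolynomial.induction_on with
  | C c => simp
  | add p q hp hq => rw [map_add, map_add, hp, hq]
  | mul_X p x hp => rw [map_mul, map_mul, hp, MvPolynomial.rename_X, MvPolynomial.aeval_X]

theorem pderiv_inr_rename_inl (x : X) (P : MvPolynomial X ℂ) :
    MvPolynomial.pderiv (.inr x) (MvPolynomial.rename (.inl : X → X ⊕ X) P) = 0 := by
  rw [rename_eq_aeval, derivation_aeval]
  simp

theorem pderiv_inl_rename_inr (x : X) (P : MvPolynomial X ℂ) :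
    MvPolynomial.pderiv (.inl x) (MvPolynomial.rename (.inr : X → X ⊕ X) P) = 0 := by
  rw [rename_eq_aeval, derivation_aeval]
  simp

theorem pderiv_inl_rename_inl (x : X) (P : MvPolynomial X ℂ) :
    MvPolynomial.pderiv (.inl x) (MvPolynomial.rename (.inl : X → X ⊕ X) P) =
      MvPolynomial.rename .inl (MvPolynomial.pderiv x P) := by
  classical
  rw [rename_eq_aeval, rename_eq_aeval, derivation_aeval, Finset.sum_eq_single x]
  · simp
  · intro y _ hy
    simp [hy]
  · simp

theorem exists_eq_add_single {X : Type*} {n : X →₀ ℕ} (hn : n ≠ 0) :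
    ∃ (m : X →₀ ℕ) (x : X), n = m + Finsupp.single x 1 := by
  obtain ⟨x, hx⟩ := Finsupp.ne_iff.1 hn
  exact ⟨n - Finsupp.single x 1, x,
    (tsub_add_cancel_of_le (by simpa [Nat.one_le_iff_ne_zero] using hx)).symm⟩

/-- Integrating by parts against a factor z_x puts ∂/∂z̄_x on a holomorphic polynomial, so every
non-constant monomial has mean zero. -/
theorem expect_rename_inl (P : MvPolynomial X ℂ) :
    expect hκ (0 : X → ℂ) (MvPolynomial.rename .inl P) = MvPolynomial.coeff 0 P := by
  classical
  induction P using MvPolynomial.induction_on' with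
  | add p q hp hq => simp [hp, hq]
  | monomial m c =>
    by_cases hm : m = 0
    · subst hm
      have h := expect_C_mul hκ (0 : X → ℂ) c 1
      rw [expect_one] at h
      simpa using h
    · obtain ⟨m', x, rfl⟩ := exists_eq_add_single hm
      have h := expect_X_inl_mul hκ (0 : X → ℂ) x
        (MvPolynomial.rename .inl (MvPolynomial.monomial m' c))
      rw [pderiv_inr_rename_inl, map_zero, Pi.zero_apply, zero_mul, sub_zero] at h
      have hk : (κ : ℂ) ≠ 0 := by exact_mod_cast hκ.ne'
      have h' := (mul_eq_zero.1 h).resolve_left hk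
      rw [MvPolynomial.monomial_add_single, pow_one, map_mul, MvPolynomial.rename_X, mul_comm, h',
        MvPolynomial.coeff_mul_X']
      simp

/-- The Gaussian moments: the variables are paired with their conjugates. -/
theorem expect_rename_mul (P : MvPolynomial X ℂ) (n : X →₀ ℕ) :
    expCoeff κ n * expect hκ (0 : X → ℂ) (MvPolynomial.rename .inl P *
      MvPolynomial.rename .inr (MvPolynomial.monomial n 1)) =
      (-1) ^ n.degree * MvPolynomial.coeff n P := by
  classical
  induction hd : n.degree generalizing n P with
  | zero =>
    rw [(Finsupp.degree_eq_zero_iff n).1 hd]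
    have h := expect_rename_inl hκ P
    simpa [expCoeff] using h
  | succ d ih =>
    have hn : n ≠ 0 := by
      rintro rfl
      simp at hd
    obtain ⟨m, x, rfl⟩ := exists_eq_add_single hn
    rw [map_add, Finsupp.degree_single, Nat.add_right_cancel_iff] at hd
    -- One factor z̄_x is traded for κ⁻¹ ∂/∂z_x acting on `P`, the conjugate monomial being
    -- antiholomorphic.
    have h := expect_X_inr_mul hκ (0 : X → ℂ) x (MvPolynomial.rename .inl P *
      MvPolynomial.rename .inr (MvPolynomial.monomial m 1))
    rw [MvPolynomial.pderiv_mul, pderiv_inl_rename_inr, pderiv_inl_rename_inl, mul_zero, add_zero,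
      Pi.zero_apply, map_zero, zero_mul, sub_zero] at h
    have h1 := ih (MvPolynomial.pderiv x P) m hd
    rw [MvPolynomial.coeff_pderiv] at h1
    have h2 := expCoeff_sub κ (n := m + Finsupp.single x 1) (x := x) (by simp)
    rw [add_tsub_cancel_right] at h2
    simp only [Finsupp.coe_add, Pi.add_apply, Finsupp.single_eq_same] at h2
    push_cast at h2
    rw [MvPolynomial.monomial_add_single, pow_one, map_mul (MvPolynomial.rename _), MvPolynomial.rename_X, ← mul_assoc,
      mul_comm _ (MvPolynomial.X _)]
    set e := expect hκ (0 : X → ℂ) (MvPolynomial.X (.inr x) * (MvPolynomial.rename .inl P *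
      MvPolynomial.rename .inr (MvPolynomial.monomial m 1)))
    have h3 : ((m x : ℂ) + 1) ≠ 0 := by exact_mod_cast (m x).succ_ne_zero
    apply mul_left_cancel₀ h3
    rw [pow_succ]
    linear_combination -e * h2 - expCoeff κ m * h - h1

theorem expCoeff_ne_zero (hκ : 0 < κ) (n : X →₀ ℕ) : expCoeff κ n ≠ 0 := by
  have h1 : (κ : ℂ) ≠ 0 := by exact_mod_cast hκ.ne'
  have h2 : ∏ y, ((n y).factorial : ℂ) ≠ 0 :=
    Finset.prod_ne_zero_iff.2 fun y _ => by exact_mod_cast (n y).factorial_ne_zero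
  exact div_ne_zero (pow_ne_zero _ (neg_ne_zero.2 h1)) h2

theorem evalConj_rename_mul (P : MvPolynomial X ℂ) (n : X →₀ ℕ) (σ : X → ℂ) :
    evalConj σ (MvPolynomial.rename .inl P *
      MvPolynomial.rename .inr (MvPolynomial.monomial n 1)) * linFactor 0 σ =
      MvPolynomial.eval σ P * ∏ x, conj (σ x) ^ n x := by
  rw [linFactor_zero, mul_one, map_mul, evalConj, MvPolynomial.eval_rename,
    MvPolynomial.eval_rename, MvPolynomial.eval_monomial, Finsupp.prod_fintype _ _ (by simp),
    one_mul]
  rfl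

theorem integrable_moment (hκ : 0 < κ) (P : MvPolynomial X ℂ) (n : X →₀ ℕ) :
    Integrable (fun σ => MvPolynomial.eval σ P * ∏ x, conj (σ x) ^ n x) (gaussian κ) := by
  have h := integrable_gaussian hκ (0 : X → ℂ) (MvPolynomial.rename .inl P *
      MvPolynomial.rename .inr (MvPolynomial.monomial n 1))
  simpa only [evalConj_rename_mul] using h

theorem expCoeff_mul_moment (hκ : 0 < κ) (P : MvPolynomial X ℂ) (n : X →₀ ℕ) :
    expCoeff κ n * moment κ (fun σ => MvPolynomial.eval σ P) n =
      (-1) ^ n.degree * MvPolynomial.coeff n P := by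
  rw [← expect_rename_mul hκ, expect, LinearMap.coe_mk, AddHom.coe_mk]
  simp only [evalConj_rename_mul]
  rfl

theorem finite_moment_ne_zero (hκ : 0 < κ) (P : MvPolynomial X ℂ) :
    {n | moment κ (fun σ => MvPolynomial.eval σ P) n ≠ 0}.Finite := by
  refine P.support.finite_toSet.subset fun n hn => ?_
  have h := expCoeff_mul_moment hκ P n
  rw [Finset.mem_coe, MvPolynomial.mem_support_iff]
  intro h0
  rw [h0, mul_zero] at h
  exact hn ((mul_eq_zero.1 h).resolve_left (expCoeff_ne_zero hκ n))

theorem evalConj_quadForm {X : Type*} (α : ι → ι → X → ℂ) (z : ι → ℂ) (x : X) :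
    evalConj z (quadForm α x) = ∑ a, ∑ b, α a b x * (z a * conj (z b)) := by
  simp [evalConj, quadForm]

theorem evalConj_aeval_quadForm {X : Type*} (α : ι → ι → X → ℂ) (z : ι → ℂ) (P : MvPolynomial X ℂ) (c : ℂ) :
    evalConj z (MvPolynomial.aeval (fun x => MvPolynomial.C c * quadForm α x) P) =
      MvPolynomial.eval (fun x => c * ∑ a, ∑ b, α a b x * (z a * conj (z b))) P := by
  induction P using MvPolynomial.induction_on with
  | C c => simp [evalConj]
  | add p q hp hq => rw [map_add, map_add, map_add, hp, hq]
  | mul_X p x hp =>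
    rw [map_mul, map_mul, map_mul, hp, MvPolynomial.aeval_X, map_mul, evalConj_quadForm,
      MvPolynomial.eval_X]
    simp [evalConj]

/-- The term by term Gaussian integral of a polynomial against the generating series of the
quadratic forms evaluates the polynomial at the negatives of the quadratic forms. -/
theorem formalIntegral_genSeries (J : ι → ℂ) (α : ι → ι → X → ℂ) (P : MvPolynomial X ℂ) :
    formalIntegral κ (fun σ => MvPolynomial.eval σ P) (genSeries hκ J α 1) =
      ∫ z, MvPolynomial.eval (fun x => -1 * ∑ a, ∑ b, α a b x * (z a * conj (z b))) P *
        linFactor J z ∂(gaussian κ) := by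
  -- The factor (-κ)^|n|/n! of the series cancels the n!/κ^|n| of the moment up to sign, and only
  -- exponents occurring in `P` survive.
  have h1 : ∀ n, MvPowerSeries.coeff n (genSeries hκ J α 1) *
      moment κ (fun σ => MvPolynomial.eval σ P) n =
      (-1) ^ n.degree * MvPolynomial.coeff n P * expect hκ J (quadMonomial α n) := by
    intro n
    rw [coeff_genSeries, mul_one, ← expCoeff_mul_moment hκ]
    ring
  rw [formalIntegral, finsum_eq_sum_of_support_subset (s := P.support)]
  · simp only [h1]
    simp_rw [← evalConj_aeval_quadForm]
    change _ = expect hκ J _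
    conv_rhs => rw [P.as_sum, map_sum, map_sum]
    refine Finset.sum_congr rfl fun n _ => ?_
    have h2 : MvPolynomial.aeval (fun x => MvPolynomial.C (-1 : ℂ) * quadForm α x)
        (MvPolynomial.monomial n (MvPolynomial.coeff n P)) =
        MvPolynomial.C ((-1) ^ n.degree * MvPolynomial.coeff n P) * quadMonomial α n := by
      rw [MvPolynomial.aeval_monomial, Finsupp.prod_fintype _ _ (by simp), quadMonomial_eq_prod]
      simp only [mul_pow, Finset.prod_mul_distrib, Finset.prod_pow_eq_pow_sum]
      rw [← Finsupp.degree_eq_sum, map_mul, map_pow, MvPolynomial.algebraMap_eq]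
      ring
    rw [h2, expect_C_mul]
  · intro n hn
    rw [Finset.mem_coe, MvPolynomial.mem_support_iff]
    intro h0
    exact hn (by simp only [h1, h0, mul_zero, zero_mul])

end Moments

/-! ### The tensor model as a case of the generating series. -/

section Tensors

variable {D N : ℕ}

/-- The coefficient of the variable `x` in the entry `(a, b)` of `∑_I σ̄_I`. -/
def boldCoeff (a b : TensorIdx D N) (x : MatrixIdx D N) : ℂ :=
  if (∀ k ∉ x.1, a k = b k) ∧ x.2 = (fun k : x.1 => a k, fun k : x.1 => b k) then 1 else 0

theorem linMatrix_boldCoeff : linMatrix boldCoeff = conjSum D N := by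
  classical
  ext1 a b
  rw [linMatrix, conjSum, Matrix.sum_apply, Fintype.sum_sigma]
  refine Finset.sum_congr rfl fun I _ => ?_
  -- For given `a`, `b`, only the entry of σ_I at their restrictions to `I` can contribute.
  rw [Fintype.sum_eq_single (fun k : I => a k, fun k : I => b k)]
  · by_cases h : ∀ k ∉ I, a k = b k
    · simp [boldCoeff, bold]
    · simp only [boldCoeff, bold, h, false_and, if_false, map_zero, zero_mul]
  · intro x hx
    simp [boldCoeff, hx]

theorem invCov_pos (hN : 1 ≤ N) : 0 < invCov D N := by
  rw [invCov]
  exact pow_pos (by exact_mod_cast hN) _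

theorem formalExp_blackPotential (hκ : 0 < invCov D N) (J : TensorIdx D N → ℂ) :
    formalExp (-blackPotential D N + sourceTerm J) = genSeries hκ J boldCoeff 1 := by
  rw [← formalExp_eq_genSeries, linMatrix_boldCoeff, ← Complex.ofReal_inv]
  rfl

theorem sourceTerm_zero : sourceTerm (0 : TensorIdx D N → ℂ) = 0 := by
  have : sourceMatrix (0 : TensorIdx D N → ℂ) = 0 := by
    ext1 i j
    simp [sourceMatrix]
  rw [sourceTerm, this, zero_mul, Matrix.trace_zero, mul_zero]

theorem sourceFactor_eq (J T : TensorIdx D N → ℂ) : sourceFactor J T = linFactor J T :=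
  rfl

/-! ### Bubble combinatorics and the comparison of the two models. -/

section Bubbles

variable {W K : Type*} [Fintype W] [Fintype K] [DecidableEq W] [DecidableEq K]

/-- The potential `V°` as a polynomial. -/
def Bubble.potentialPoly (G : Bubble D W K) (Ω : W ≃ K) (N : ℕ) :
    MvPolynomial (MatrixIdx D N) ℂ :=
  ∑ i : (w : W) → G.colors Ω w → Fin N, ∑ j : (w : W) → G.colors Ω w → Fin N,
    (∏ w, MvPolynomial.X ⟨G.colors Ω w, i w, j w⟩) *
      MvPolynomial.C (∏ w, ∏ q : G.colors Ω w,
        if i w q = j (Ω.symm (G.edge q w)) ⟨q, G.mem_colors Ω q.2⟩ then 1 else 0)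

theorem Bubble.eval_potentialPoly {W K : Type*} [Fintype W] [DecidableEq W]
    [DecidableEq K] (G : Bubble D W K) (Ω : W ≃ K) (σ : MatrixIdx D N → ℂ) :
    MvPolynomial.eval σ (G.potentialPoly Ω N) = G.potential Ω N σ := by
  simp only [potentialPoly, potential, map_sum, map_mul, map_prod, MvPolynomial.eval_X,
    MvPolynomial.eval_C]

theorem Bubble.potential_const_mul {W K : Type*} [Fintype W] [DecidableEq W]
    [DecidableEq K] (G : Bubble D W K) (Ω : W ≃ K) (c : ℂ)
    (σ : MatrixIdx D N → ℂ) :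
    G.potential Ω N (fun x => c * σ x) = c ^ Fintype.card W * G.potential Ω N σ := by
  simp only [potential, Finset.mul_sum, Finset.prod_mul_distrib, Finset.prod_const,
    Finset.card_univ, mul_assoc]

/-- For a white vertex, the indices at both ends of all its edges agree if and only if they agree
for the edges that join the vertex to its partner and for those that do not. -/
theorem Bubble.prod_edges {W K : Type*} [DecidableEq K] (G : Bubble D W K) (Ω : W ≃ K) (a b : W → TensorIdx D N) (w : W) :
    (∏ c, if a w c = b (Ω.symm (G.edge c w)) c then (1 : ℂ) else 0) =
      (if ∀ k ∉ G.colors Ω w, a w k = b w k then 1 else 0) *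
        ∏ q : G.colors Ω w, if a w q = b (Ω.symm (G.edge q w)) q then 1 else 0 := by
  rw [← Finset.prod_mul_prod_compl (G.colors Ω w), mul_comm]
  congr 1
  · rw [Finset.prod_ite_zero]
    simp only [Finset.prod_const_one, Finset.mem_compl]
    congr 1
    refine propext (forall₂_congr fun k hk => ?_)
    have : Ω.symm (G.edge k w) = w := by
      have h : G.edge k w = Ω w := by simpa [colors] using hk
      rw [h, Ω.symm_apply_apply]
    rw [this]
  · exact (Finset.prod_coe_sort (G.colors Ω w)
      (fun c => if a w c = b (Ω.symm (G.edge c w)) c then (1 : ℂ) else 0)).symm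

/-- Black vertices are relabelled by their white partners, so that everything becomes a product over
pairs. -/
theorem Bubble.invariant_eq (G : Bubble D W K) (Ω : W ≃ K) (T : TensorIdx D N → ℂ) :
    G.invariant N T = ∑ a : W → TensorIdx D N, ∑ b : W → TensorIdx D N,
      ∏ w, ((T (a w) * conj (T (b w))) *
        ((if ∀ k ∉ G.colors Ω w, a w k = b w k then 1 else 0) *
          ∏ q : G.colors Ω w, if a w q = b (Ω.symm (G.edge q w)) q then 1 else 0)) := by
  rw [invariant]
  refine Finset.sum_congr rfl fun a _ => ?_
  refine Fintype.sum_equiv (Ω.symm.arrowCongr (Equiv.refl _)) _ _ fun j => ?_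
  simp only [← prod_edges, Finset.prod_mul_distrib]
  rw [Finset.prod_comm]
  congr 1
  · congr 1
    exact Fintype.prod_equiv Ω.symm _ _ fun k => by simp [Equiv.arrowCongr]
  · simp [Equiv.arrowCongr]

/-- The potential of the quadratic forms `∑ T_a T̄_b` is the invariant of the bubble. -/
theorem Bubble.potential_quad (G : Bubble D W K) (Ω : W ≃ K) (T : TensorIdx D N → ℂ) :
    G.potential Ω N (fun x => ∑ a, ∑ b, boldCoeff a b x * (T a * conj (T b))) =
      G.invariant N T := by
  rw [invariant_eq G Ω, potential]
  have h1 : ∀ i j : (w : W) → G.colors Ω w → Fin N,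
      ∏ w, ∑ a, ∑ b, boldCoeff a b ⟨G.colors Ω w, i w, j w⟩ * (T a * conj (T b)) =
      ∑ a : W → TensorIdx D N, ∑ b : W → TensorIdx D N,
        ∏ w, boldCoeff (a w) (b w) ⟨G.colors Ω w, i w, j w⟩ * (T (a w) * conj (T (b w))) := by
    intro i j
    rw [Fintype.prod_sum]
    exact Finset.sum_congr rfl fun a _ => Fintype.prod_sum _
  simp only [h1, Finset.sum_mul]
  rw [Finset.sum_congr rfl fun i _ => Finset.sum_comm, Finset.sum_comm]
  refine Finset.sum_congr rfl fun a _ => ?_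
  rw [Finset.sum_congr rfl fun i _ => Finset.sum_comm, Finset.sum_comm]
  refine Finset.sum_congr rfl fun b _ => ?_
  have hb : ∀ (i j : (w : W) → G.colors Ω w → Fin N) (w : W),
      (i w ≠ (fun k : G.colors Ω w => a w k) ∨ j w ≠ (fun k : G.colors Ω w => b w k)) →
      ∏ w, boldCoeff (a w) (b w) ⟨G.colors Ω w, i w, j w⟩ * (T (a w) * conj (T (b w))) = 0 := by
    intro i j w h
    refine Finset.prod_eq_zero (Finset.mem_univ w) ?_
    rw [boldCoeff, if_neg, zero_mul]
    rintro ⟨-, h'⟩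
    rcases h with h | h
    · exact h (congrArg Prod.fst h')
    · exact h (congrArg Prod.snd h')
  -- The coefficients force `i` and `j` to be the restrictions of `a` and `b`, so both sums
  -- collapse; their remaining indicator is the contraction between partners.
  rw [Fintype.sum_eq_single (fun w (k : G.colors Ω w) => a w k),
    Fintype.sum_eq_single (fun w (k : G.colors Ω w) => b w k)]
  · rw [← Finset.prod_mul_distrib]
    refine Finset.prod_congr rfl fun w _ => ?_
    simp only [boldCoeff, and_true]
    ring
  · intro j hj
    obtain ⟨w, hw⟩ := Function.ne_iff.1 hj
    rw [hb _ j w (.inr hw), zero_mul]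
  · intro i hi
    obtain ⟨w, hw⟩ := Function.ne_iff.1 hi
    exact Finset.sum_eq_zero fun j _ => by rw [hb i j w (.inl hw), zero_mul]

/-- This exhibits powers of the invariant as polynomials in T and T̄, from which integrability
follows; `C 1` fits the form of `evalConj_aeval_quadForm`. -/
theorem Bubble.evalConj_invariant (G : Bubble D W K) (Ω : W ≃ K) (p : ℕ)
    (T : TensorIdx D N → ℂ) :
    evalConj T (MvPolynomial.aeval (fun x => MvPolynomial.C 1 * quadForm boldCoeff x)
      (G.potentialPoly Ω N) ^ p) = G.invariant N T ^ p := by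
  rw [map_pow, evalConj_aeval_quadForm, G.eval_potentialPoly Ω, ← G.potential_quad Ω]
  simp only [one_mul]

theorem Bubble.integrable_invariant (G : Bubble D W K) (Ω : W ≃ K) (hκ : 0 < invCov D N) (p : ℕ)
    (J : TensorIdx D N → ℂ) :
    Integrable (fun T => G.invariant N T ^ p * sourceFactor J T) (gaussian (invCov D N)) := by
  have h := integrable_gaussian hκ J (MvPolynomial.aeval
    (fun x => MvPolynomial.C 1 * quadForm boldCoeff x) (G.potentialPoly Ω N) ^ p)
  simpa only [G.evalConj_invariant Ω, sourceFactor_eq] using h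

theorem Bubble.formalIntegral_potential (G : Bubble D W K) (Ω : W ≃ K) (hκ : 0 < invCov D N)
    (p : ℕ) (J : TensorIdx D N → ℂ) :
    formalIntegral (invCov D N) (fun σ => G.potential Ω N σ ^ p)
      (formalExp (-blackPotential D N + sourceTerm J)) =
      ((-1) ^ Fintype.card W) ^ p *
        ∫ T, G.invariant N T ^ p * sourceFactor J T ∂(gaussian (invCov D N)) := by
  have h := formalIntegral_genSeries hκ J boldCoeff (G.potentialPoly Ω N ^ p)
  simp only [map_pow, G.eval_potentialPoly Ω, G.potential_const_mul Ω (-1), G.potential_quad Ω,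
    mul_pow ((-1 : ℂ) ^ Fintype.card W), mul_assoc] at h
  rw [formalExp_blackPotential hκ, h, integral_const_mul]
  rfl

theorem Bubble.tensorGenerating_eq (G : Bubble D W K) (Ω : W ≃ K) (hκ : 0 < invCov D N) (s : ℝ)
    (J : TensorIdx D N → ℂ) :
    tensorGenerating G N s J = matrixGenerating G Ω N s J := by
  ext p
  rw [tensorGenerating, matrixGenerating, PowerSeries.coeff_mk, PowerSeries.coeff_mk,
    G.formalIntegral_potential Ω hκ, ← mul_neg, mul_pow, mul_div_assoc]
  -- One sign comes from the coupling, the other from evaluating the potential at -Y.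
  have h : (((-1 : ℂ) ^ Fintype.card W) ^ p) * ((-1 : ℂ) ^ Fintype.card W) ^ p = 1 := by
    rw [← mul_pow, ← mul_pow]
    norm_num
  linear_combination -((-(((N : ℝ) ^ s : ℝ) : ℂ)) ^ p / (p.factorial : ℂ) *
    ∫ T, G.invariant N T ^ p * sourceFactor J T ∂(gaussian (invCov D N))) * h

theorem tensorGenerating_zero (G : Bubble D W K) (s : ℝ) :
    tensorGenerating G N s 0 = tensorPartition G N s := by
  simp only [tensorGenerating, tensorPartition, sourceFactor_eq, linFactor_zero, mul_one]

theorem matrixGenerating_zero {W K : Type*} [Fintype W] [DecidableEq W]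
    [DecidableEq K] (G : Bubble D W K) (Ω : W ≃ K) (s : ℝ) :
    matrixGenerating G Ω N s 0 = matrixPartition G Ω N s := by
  simp only [matrixGenerating, matrixPartition, sourceTerm_zero, add_zero]

/-- At order zero the integral is exp(κ⁻¹ ∑ |J_a|²), so the logarithm is meaningful. -/
theorem constantCoeff_tensorGenerating_ne_zero (G : Bubble D W K) (hκ : 0 < invCov D N) (s : ℝ)
    (J : TensorIdx D N → ℂ) :
    PowerSeries.constantCoeff (tensorGenerating G N s J) ≠ 0 := by
  have h := expect_one hκ J
  rw [expect, LinearMap.coe_mk, AddHom.coe_mk] at h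
  simp only [map_one, one_mul] at h
  rw [← PowerSeries.coeff_zero_eq_constantCoeff_apply, tensorGenerating, PowerSeries.coeff_mk]
  simp only [pow_zero, Nat.factorial_zero, Nat.cast_one, div_one, one_mul, sourceFactor_eq]
  rw [h]
  exact Complex.exp_ne_zero _

end Bubbles

end Tensors

end TensorMatrix

end

theorem mainTheorem6 {W K : Type*} [Fintype W] [Fintype K] [DecidableEq W] [DecidableEq K]
    (D N : ℕ) (hD : 2 ≤ D) (hN : 1 ≤ N) (s : ℝ)
    (G : TensorMatrix.Bubble D W K) (Ω : W ≃ K) :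
    -- the integrals that define the coefficients converge,
    -- and the term by term matrix integrals are finite sums
    (∀ (p : ℕ) (J : TensorMatrix.TensorIdx D N → ℂ),
      Integrable (fun T => G.invariant N T ^ p * TensorMatrix.sourceFactor J T)
        (TensorMatrix.gaussian (TensorMatrix.invCov D N))) ∧
    (∀ p : ℕ,
      Integrable (fun T => G.invariant N T ^ p)
        (TensorMatrix.gaussian (TensorMatrix.invCov D N))) ∧
    (∀ (p : ℕ) (n : TensorMatrix.MatrixIdx D N →₀ ℕ),
      Integrable (fun σ => G.potential Ω N σ ^ p * ∏ x, (starRingEnd ℂ) (σ x) ^ n x)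
        (TensorMatrix.gaussian (TensorMatrix.invCov D N))) ∧
    (∀ p : ℕ, {n | TensorMatrix.moment (TensorMatrix.invCov D N)
      (fun σ => G.potential Ω N σ ^ p) n ≠ 0}.Finite) ∧
    -- the partition functions agree order by order
    TensorMatrix.tensorPartition G N s = TensorMatrix.matrixPartition G Ω N s ∧
    -- the generating functions with sources agree order by order, and so do their logarithms
    (∀ J : TensorMatrix.TensorIdx D N → ℂ,
      TensorMatrix.tensorGenerating G N s J = TensorMatrix.matrixGenerating G Ω N s J ∧
      PowerSeries.constantCoeff (TensorMatrix.tensorGenerating G N s J) ≠ 0 ∧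
      TensorMatrix.seriesLog (TensorMatrix.tensorGenerating G N s J) =
        TensorMatrix.seriesLog (TensorMatrix.matrixGenerating G Ω N s J)) := by
  have hκ := TensorMatrix.invCov_pos (D := D) hN
  refine ⟨fun p J => G.integrable_invariant Ω hκ p J, fun p => ?_, fun p n => ?_, fun p => ?_, ?_,
    fun J => ⟨G.tensorGenerating_eq Ω hκ s J,
      TensorMatrix.constantCoeff_tensorGenerating_ne_zero G hκ s J,
      by rw [G.tensorGenerating_eq Ω hκ s J]⟩⟩
  · have h := G.integrable_invariant Ω hκ p 0
    simpa only [TensorMatrix.sourceFactor_eq, TensorMatrix.linFactor_zero, mul_one] using h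
  · have h := TensorMatrix.integrable_moment hκ (G.potentialPoly Ω N ^ p) n
    simpa only [map_pow, G.eval_potentialPoly Ω] using h
  · have h := TensorMatrix.finite_moment_ne_zero hκ (G.potentialPoly Ω N ^ p)
    simpa only [map_pow, G.eval_potentialPoly Ω] using h
  · rw [← TensorMatrix.tensorGenerating_zero, ← TensorMatrix.matrixGenerating_zero,
      G.tensorGenerating_eq Ω hκ]
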